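/- Let $\mu$ be a $\sigma$-finite measure on $\mathbb{R}$ and $d\ge 1$ an integer. For a subset $T$ of a metric space and $\epsilon>0$, let $N(\epsilon,T)$ be the minimal number of balls of radius $\epsilon$ needed to cover $T$, and let ${\cal H}(\epsilon,T):=\log N(\epsilon,T)$. For functions $h,g$ of $\epsilon$ with $g>0$ near $0$, write $h(\epsilon)\lesssim g(\epsilon)$ if $\limsup_{\epsilon\downarrow 0}h(\epsilon)/g(\epsilon)<\infty$. Let $\Psi=\{\psi_v:\ v\in[0,1]\}\subset L_2(\mu)$ be a collection of real functions with $L_2(\mu)$-norm at most $1$, and suppose that for some constant $V>0$ $$N(\epsilon,\Psi)\lesssim\epsilon^{-V}.$$ Let $\{{\cal V}_k\}_{k\ge 0}$ be a nested sequence of approximations of $\Psi$ with parameters $(q,\gamma,W)$, where $q\ge 1$ is an integer and $\gamma,W>0$; that is, ${\cal V}_0\subset{\cal V}_1\subset\cdots$ are linear subspaces of $L_2(\mu)$ with $\dim({\cal V}_k)=q2^k$ for all $k\ge 0$, and for all $k\ge 1$ and all $v\in[0,1]$ $$\min_{f\in{\cal V}_k}\int(\psi_v-f)^2\,d\mu\le\gamma^2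 2^{-2k/W}.$$ Let ${\cal F}:={\rm absconv}(\Psi\otimes\cdots\otimes\Psi)\subset L_2(\mu\times\cdots\times\mu)$ ($d$ factors) be the closure in $L_2(\mu\times\cdots\times\mu)$ of the set of all functions $$(u_1,\ldots,u_d)\mapsto\sum_{v_1\in V_1}\cdots\sum_{v_d\in V_d}\beta_{v_1,\ldots,v_d}\,\psi_{v_1}(u_1)\cdots\psi_{v_d}(u_d),$$ where $V_1,\ldots,V_d$ are finite subsets of $[0,1]$ and the $\beta_{v_1,\ldots,v_d}$ are real numbers with $\sum_{v_1\in V_1,\ldots,v_d\in V_d}|\beta_{v_1,\ldots,v_d}|\le 1$. Then $${\cal H}(\epsilon,{\cal F})\lesssim\epsilon^{-\frac{2W}{2+W}}\,\log^{d-1}(1/\epsilon)\,\log^{\frac{W}{2+W}}(1/\epsilon).$$ -/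

import Mathlib

open MeasureTheory Filter Topology
open scoped ENNReal NNReal

noncomputable section

namespace TensorEntropy

/-- The order relation `h ≲ g` as `ε ↓ 0`: `limsup_{ε ↓ 0} h(ε) / g(ε) < ∞`.
The function `h` may take the value `∞`. -/
def LesssimZero (h : ℝ → EReal) (g : ℝ → ℝ) : Prop :=
  limsup (fun ε : ℝ => h ε / (g ε : EReal)) (𝓝[>] (0 : ℝ)) < ⊤

/-- The covering number `N(ε, T)` of a subset `T` of a metric space: the minimal number (possibly
`∞`) of closed balls of radius `ε`, centred anywhere in the metric space, that cover `T`. -/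
def coveringNum {E : Type*} [PseudoMetricSpace E] (T : Set E) (ε : ℝ) : ℝ≥0∞ :=
  ((Metric.externalCoveringNumber ε.toNNReal T : ℕ∞) : ℝ≥0∞)

/-- The entropy `H(ε, T) = log N(ε, T)`. -/
def entropy {E : Type*} [PseudoMetricSpace E] (T : Set E) (ε : ℝ) : EReal :=
  ENNReal.log (coveringNum T ε)

theorem memLp_tensor (μ : Measure ℝ) [SigmaFinite μ] {d : ℕ} (f : Fin d → Lp ℝ 2 μ) :
    MemLp (fun u : Fin d → ℝ => ∏ i, f i (u i)) 2 (Measure.pi fun _ : Fin d => μ) := by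
  have hm : AEStronglyMeasurable (fun u : Fin d → ℝ => ∏ i, f i (u i))
      (Measure.pi fun _ : Fin d => μ) :=
    Finset.aestronglyMeasurable_fun_prod _ fun i _ =>
      (Lp.aestronglyMeasurable (f i)).comp_quasiMeasurePreserving
        (Measure.quasiMeasurePreserving_eval (fun _ : Fin d => μ) i)
  rw [memLp_two_iff_integrable_sq hm]
  have h := Integrable.fintype_prod (ι := Fin d) (μ := fun _ => μ)
    (f := fun i x => (f i x) ^ 2) fun i => (Lp.memLp (f i)).integrable_sq
  simpa [Finset.prod_pow] using h

/-- The elementary tensor `f₁ ⊗ ⋯ ⊗ f_d ∈ L₂(μ × ⋯ × μ)`, that is, the (class of the) function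
`(u₁, …, u_d) ↦ f₁(u₁) ⋯ f_d(u_d)`. -/
def tensor (μ : Measure ℝ) [SigmaFinite μ] {d : ℕ} (f : Fin d → Lp ℝ 2 μ) :
    Lp ℝ 2 (Measure.pi fun _ : Fin d => μ) :=
  (memLp_tensor μ f).toLp _

/-- The absolute convex hull of the `d`-fold tensor `Ψ ⊗ ⋯ ⊗ Ψ`: the closure in
`L₂(μ × ⋯ × μ)` of the set of all sums
`∑_{v ∈ V₁ × ⋯ × V_d} β_v ψ_{v₁} ⊗ ⋯ ⊗ ψ_{v_d}`, with `V₁, …, V_d` finite subsets of the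
parameter space and `∑_{v ∈ V₁ × ⋯ × V_d} |β_v| ≤ 1`. -/
def absconvTensor {Θ : Type*} (μ : Measure ℝ) [SigmaFinite μ] (d : ℕ) (ψ : Θ → Lp ℝ 2 μ) :
    Set (Lp ℝ 2 (Measure.pi fun _ : Fin d => μ)) :=
  closure {f | ∃ (V : Fin d → Finset Θ) (β : (Fin d → Θ) → ℝ),
    ∑ v ∈ Fintype.piFinset V, |β v| ≤ 1 ∧
    f = ∑ v ∈ Fintype.piFinset V, β v • tensor μ fun i => ψ (v i)}

/-- `(V_k)_{k ≥ 0}` is a nested sequence of approximations of `Ψ = {ψ_v}` in `L₂(μ)` with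
parameters `(q, γ, W)`: it is an increasing sequence of linear subspaces with
`dim V_k = q 2^k`, and, for all `k ≥ 1` and all `v`, the minimum over `f ∈ V_k` of
`∫ (ψ_v - f)² dμ` is at most `γ² 2^{-2k/W}`. -/
structure IsNestedApprox {Θ : Type*} {μ : Measure ℝ} (ψ : Θ → Lp ℝ 2 μ) (q : ℕ) (γ W : ℝ)
    (V : ℕ → Submodule ℝ (Lp ℝ 2 μ)) : Prop where
  q_pos : 1 ≤ q
  γ_pos : 0 < γ
  W_pos : 0 < W
  nested : Monotone V
  finrank_eq : ∀ k : ℕ, Module.finrank ℝ (V k) = q * 2 ^ k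
  approx : ∀ k : ℕ, 1 ≤ k → ∀ v : Θ, ∃ f ∈ V k,
    ∫ u, (ψ v u - f u) ^ 2 ∂μ ≤ γ ^ 2 * (2 : ℝ) ^ (-(2 * (k : ℝ) / W))

end TensorEntropy

end

/-! Put `ρ = 2^(-1/W)`. Successive projections onto the spaces `𝒱 k` split each `ψ v` into
orthogonal increments of norm `O(ρ^k)`. Multiplying out a tensor and collecting the multi-indices
with `∑ k i = j` (a hyperbolic cross) gives a level-`j` part that lies in a space of dimension
`O(j^(d-1) 2^j)`. By orthogonality its squared norm is `O(j^(d-1) ρ^(2j))`. Everything above level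
`K` goes into one tail (`exists_hyperbolic_decomposition`).

Covering `Ψ` at radius of order `τ^K`, with `τ = ρ/√2`, reduces the hull to one with `exp(O(K))`
extreme points, up to an error `O(τ^K)`. With `M = K^(d-1)`, Maurey's method with about `2^j M / K`
draws covers level `j` to within `O(√K τ^j)` at cost `O(2^j M + K)` (`exists_finset_absHull`). The
residual stays in the level-`j` space, so a volume argument shrinks the radius to `√K τ^K
2^(-(K-j))` at cost `O(2^j M (K-j))`. Radii and costs both sum geometrically: the tensor hull has
entropy `O(2^K K^(d-1))` at radius of order `√K τ^K` (`exists_hasCover_absHull_tensor`).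

Setting `ε` to this radius gives `K` of order `log(1/ε)` and `2^K` of order `(√K/ε)^p`, with `p =
2W/(2+W)`. The factor `√K`, the price of the logarithm in Maurey's cost, becomes the last power of
the logarithm. -/

namespace TensorEntropy

/-! ### Calculus of finite covers -/

/-- The set `S` is covered by at most `exp B` closed balls of radius `ε`. -/
def HasCover {E : Type*} [SeminormedAddCommGroup E] (S : Set E) (ε B : ℝ) : Prop :=
  ∃ C : Finset E, (C.card : ℝ) ≤ Real.exp B ∧ ∀ x ∈ S, ∃ c ∈ C, ‖x - c‖ ≤ ε

section Cover

variable {E : Type*} [SeminormedAddCommGroup E]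

theorem HasCover.mono {S S' : Set E} {ε ε' B B' : ℝ} (h : HasCover S ε B) (hS : S' ⊆ S)
    (hε : ε ≤ ε') (hB : B ≤ B') : HasCover S' ε' B' := by
  obtain ⟨C, hC, hcov⟩ := h
  refine ⟨C, hC.trans (Real.exp_le_exp.2 hB), fun x hx => ?_⟩
  obtain ⟨c, hc, hxc⟩ := hcov x (hS hx)
  exact ⟨c, hc, hxc.trans hε⟩

theorem hasCover_singleton (x : E) : HasCover {x} 0 0 :=
  ⟨{x}, by simp, by simp⟩

theorem HasCover.add {S S' U : Set E} {ε ε' B B' : ℝ} (h : HasCover S ε B)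
    (h' : HasCover S' ε' B') (hU : ∀ u ∈ U, ∃ x ∈ S, ∃ y ∈ S', u = x + y) :
    HasCover U (ε + ε') (B + B') := by
  classical
  obtain ⟨C, hC, hcov⟩ := h
  obtain ⟨C', hC', hcov'⟩ := h'
  refine ⟨(C ×ˢ C').image fun p => p.1 + p.2, ?_, ?_⟩
  · calc (((C ×ˢ C').image fun p => p.1 + p.2).card : ℝ) ≤ ((C ×ˢ C').card : ℝ) := by
          exact_mod_cast Finset.card_image_le
      _ = C.card * C'.card := by simp
      _ ≤ Real.exp B * Real.exp B' := by gcongr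
      _ = Real.exp (B + B') := (Real.exp_add _ _).symm
  · intro u hu
    obtain ⟨x, hx, y, hy, rfl⟩ := hU u hu
    obtain ⟨c, hc, hxc⟩ := hcov x hx
    obtain ⟨c', hc', hyc⟩ := hcov' y hy
    refine ⟨c + c', Finset.mem_image.2 ⟨(c, c'), by simp [hc, hc'], rfl⟩, ?_⟩
    calc ‖x + y - (c + c')‖ = ‖(x - c) + (y - c')‖ := by congr 1; abel
      _ ≤ _ := norm_add_le_of_le hxc hyc

theorem HasCover.sum {n : ℕ} {S : ℕ → Set E} {ε B : ℕ → ℝ}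
    (h : ∀ j < n, HasCover (S j) (ε j) (B j)) :
    HasCover {u | ∃ x : ℕ → E, (∀ j < n, x j ∈ S j) ∧ u = ∑ j ∈ Finset.range n, x j}
      (∑ j ∈ Finset.range n, ε j) (∑ j ∈ Finset.range n, B j) := by
  induction n with
  | zero => simpa using hasCover_singleton (0 : E)
  | succ n ih =>
    rw [Finset.sum_range_succ, Finset.sum_range_succ]
    refine (ih fun j hj => h j (by omega)).add (h n (by omega)) ?_
    rintro u ⟨x, hx, rfl⟩
    exact ⟨_, ⟨x, fun j hj => hx j (by omega), rfl⟩, x n, hx n (by omega),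
      Finset.sum_range_succ _ _⟩

/-- A finite union of closed balls is closed, so the closure in the definition of the hull costs
nothing. -/
theorem HasCover.closure {S : Set E} {ε B : ℝ} (h : HasCover S ε B) :
    HasCover (closure S) ε B := by
  obtain ⟨C, hC, hcov⟩ := h
  refine ⟨C, hC, fun x hx => ?_⟩
  have hcl : IsClosed (⋃ c ∈ C, Metric.closedBall c ε) :=
    C.finite_toSet.isClosed_biUnion fun c _ => Metric.isClosed_closedBall
  have hsub : S ⊆ ⋃ c ∈ C, Metric.closedBall c ε := fun y hy => by
    obtain ⟨c, hc, hyc⟩ := hcov y hy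
    simp only [Set.mem_iUnion]
    exact ⟨c, hc, by rwa [mem_closedBall_iff_norm]⟩
  have := closure_minimal hsub hcl hx
  simp only [Set.mem_iUnion] at this
  obtain ⟨c, hc, hyc⟩ := this
  exact ⟨c, hc, by rwa [mem_closedBall_iff_norm] at hyc⟩

theorem HasCover.thicken {S S' : Set E} {ε ε' B : ℝ} (h : HasCover S ε B)
    (h' : ∀ x ∈ S', ∃ y ∈ S, ‖x - y‖ ≤ ε') : HasCover S' (ε + ε') B := by
  obtain ⟨C, hC, hcov⟩ := h
  refine ⟨C, hC, fun x hx => ?_⟩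
  obtain ⟨y, hy, hxy⟩ := h' x hx
  obtain ⟨c, hc, hyc⟩ := hcov y hy
  refine ⟨c, hc, ?_⟩
  calc ‖x - c‖ = ‖(y - c) + (x - y)‖ := by congr 1; abel
    _ ≤ _ := norm_add_le_of_le hyc hxy

theorem HasCover.entropy_le {S : Set E} {ε B : ℝ} (h : HasCover S ε B) :
    entropy S ε ≤ (B : EReal) := by
  obtain ⟨C, hC, hcov⟩ := h
  have hC' : Metric.IsCover ε.toNNReal S (C : Set E) := by
    intro x hx
    obtain ⟨c, hc, hxc⟩ := hcov x hx
    refine ⟨c, hc, ?_⟩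
    simp only [Set.mem_ofPred_eq, edist_dist, dist_eq_norm]
    exact ENNReal.ofReal_le_ofReal hxc
  have h1 := hC'.externalCoveringNumber_le_encard
  rw [Set.encard_coe_eq_coe_finsetCard] at h1
  have h2 : coveringNum S ε ≤ ENNReal.ofReal (Real.exp B) := by
    calc coveringNum S ε ≤ (((C.card : ℕ) : ℕ∞) : ℝ≥0∞) := by
          unfold coveringNum; exact_mod_cast h1
      _ = ENNReal.ofReal (C.card : ℝ) := by simp
      _ ≤ _ := ENNReal.ofReal_le_ofReal hC
  calc entropy S ε ≤ ENNReal.log (ENNReal.ofReal (Real.exp B)) := ENNReal.log_monotone h2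
    _ = B := by rw [ENNReal.log_ofReal_of_pos (Real.exp_pos _), Real.log_exp]

end Cover

/-! ### Volume bounds in finite dimension -/

section Volume

variable {E : Type*} [NormedAddCommGroup E] [NormedSpace ℝ E]

/-- A separated set of maximal size is a net. Rescaling by `2 / r` gives a 1-separated set in the
ball of radius 2, hence at most `5^dim` points. -/
theorem hasCover_closedBall_half [FiniteDimensional ℝ E] {r : ℝ} (hr : 0 < r) :
    HasCover (Metric.closedBall (0 : E) r) (r / 2) (Module.finrank ℝ E * Real.log 5) := by
  classical
  -- a maximal `r / 2`-separated subset
  let P : ℕ → Prop := fun n => ∃ s : Finset E, (∀ c ∈ s, ‖c‖ ≤ r) ∧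
    (∀ c ∈ s, ∀ e ∈ s, c ≠ e → r / 2 ≤ ‖c - e‖) ∧ s.card = n
  have hbound : ∀ n, P n → n ≤ 5 ^ Module.finrank ℝ E := by
    rintro n ⟨s, hs, hsep, rfl⟩
    have hinj : Function.Injective fun x : E => (2 / r) • x :=
      smul_right_injective E (by positivity)
    rw [← Finset.card_image_of_injective s hinj]
    apply Besicovitch.card_le_of_separated
    · intro c hc
      obtain ⟨x, hx, rfl⟩ := Finset.mem_image.1 hc
      rw [norm_smul, Real.norm_of_nonneg (by positivity), div_mul_eq_mul_div, div_le_iff₀ hr]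
      nlinarith [hs x hx]
    · intro c hc e he hce
      obtain ⟨x, hx, rfl⟩ := Finset.mem_image.1 hc
      obtain ⟨y, hy, rfl⟩ := Finset.mem_image.1 he
      have hxy : x ≠ y := fun h => hce (by rw [h])
      rw [← smul_sub, norm_smul, Real.norm_of_nonneg (by positivity), div_mul_eq_mul_div,
        le_div_iff₀ hr]
      nlinarith [hsep x hx y hy hxy]
  have h0 : P 0 := ⟨∅, by simp, by simp, by simp⟩
  obtain ⟨s, hs, hsep, hcard⟩ := Nat.findGreatest_spec (P := P) (Nat.zero_le _) h0
  refine ⟨s, ?_, ?_⟩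
  · have : s.card ≤ 5 ^ Module.finrank ℝ E := hbound _ ⟨s, hs, hsep, rfl⟩
    rw [← Real.log_pow, Real.exp_log (by positivity)]
    exact_mod_cast this
  · intro x hx
    by_contra! hfar
    have hxs : x ∉ s := fun h => by
      have := hfar x h
      simp at this
      linarith
    have hP : P (s.card + 1) := by
      refine ⟨insert x s, ?_, ?_, Finset.card_insert_of_notMem hxs⟩
      · intro c hc
        rcases Finset.mem_insert.1 hc with rfl | hc
        · simpa using hx
        · exact hs c hc
      · intro c hc e he hce
        rcases Finset.mem_insert.1 hc with rfl | hc' <;>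
          rcases Finset.mem_insert.1 he with rfl | he'
        · exact absurd rfl hce
        · exact (hfar e he').le
        · rw [norm_sub_rev]; exact (hfar c hc').le
        · exact hsep c hc' e he' hce
    have h1 : s.card + 1 ≤ Nat.findGreatest P (5 ^ Module.finrank ℝ E) :=
      Nat.le_findGreatest (hbound _ hP) hP
    rw [← hcard] at h1
    exact absurd h1 (by simp)

theorem hasCover_closedBall_two_pow [FiniteDimensional ℝ E] {r : ℝ} (hr : 0 < r) (s : ℕ) :
    HasCover (Metric.closedBall (0 : E) r) (r / 2 ^ s)
      (Module.finrank ℝ E * s * Real.log 5) := by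
  induction s with
  | zero =>
    exact ⟨{0}, by simp, fun x hx => ⟨0, by simp, by simpa using mem_closedBall_zero_iff.1 hx⟩⟩
  | succ s ih =>
    classical
    obtain ⟨C, hC, hcov⟩ := ih
    have hr' : 0 < r / 2 ^ s := by positivity
    have h := (show HasCover (C : Set E) 0 (Module.finrank ℝ E * s * Real.log 5) from
      ⟨C, hC, fun x hx => ⟨x, hx, by simp⟩⟩).add (hasCover_closedBall_half (E := E) hr')
      (U := Metric.closedBall (0 : E) r) (fun u hu => by
        obtain ⟨c, hc, huc⟩ := hcov u hu
        exact ⟨c, hc, u - c, by simpa using huc, by abel⟩)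
    refine h.mono subset_rfl (le_of_eq ?_) (le_of_eq ?_)
    · rw [pow_succ]; field_simp; simp
    · push_cast; ring

theorem hasCover_submodule_ball (U : Submodule ℝ E) [FiniteDimensional ℝ U] {r D : ℝ}
    (hr : 0 < r) (s : ℕ) (hD : (Module.finrank ℝ U : ℝ) ≤ D) :
    HasCover {x : E | x ∈ U ∧ ‖x‖ ≤ r} (r / 2 ^ s) (D * s * Real.log 5) := by
  classical
  obtain ⟨C, hC, hcov⟩ := hasCover_closedBall_two_pow (E := U) hr s
  refine ⟨C.image (fun x : U => (x : E)), ?_, ?_⟩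
  · refine (Nat.cast_le.2 Finset.card_image_le).trans (hC.trans (Real.exp_le_exp.2 ?_))
    have : 0 ≤ Real.log 5 := Real.log_nonneg (by norm_num)
    gcongr
  · rintro x ⟨hxU, hx⟩
    obtain ⟨c, hc, hxc⟩ := hcov ⟨x, hxU⟩ (by simpa using hx)
    exact ⟨c, Finset.mem_image_of_mem _ hc, hxc⟩

end Volume

/-! ### Maurey's empirical method -/

/-- The absolute convex hull of a finite family of vectors. -/
def absHull {E ι : Type*} [AddCommGroup E] [Module ℝ E] [Fintype ι] (x : ι → E) : Set E :=
  {y | ∃ β : ι → ℝ, ∑ i, |β i| ≤ 1 ∧ y = ∑ i, β i • x i}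

section Maurey

variable {E : Type*} [NormedAddCommGroup E] [InnerProductSpace ℝ E]

/-- For random `a` with law `w`, the vector `p a` minus its mean is centred with variance at most `δ
^ 2`. The average of the left side is thus at most the right side, and some `a` does no worse than
average. -/
theorem exists_norm_add_sub_sq_le {A : Type*} [Fintype A] {w : A → ℝ} (hw : ∀ a, 0 ≤ w a)
    (hw1 : ∑ a, w a = 1) {p : A → E} {δ : ℝ} (hp : ∀ a, ‖p a‖ ≤ δ) (s : E) :
    ∃ a, ‖s + (p a - ∑ b, w b • p b)‖ ^ 2 ≤ ‖s‖ ^ 2 + δ ^ 2 := by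
  set y := ∑ b, w b • p b with hy
  by_contra! hlt
  have hexp : ∀ a, w a * ‖s + (p a - y)‖ ^ 2
      = w a * ‖s - y‖ ^ 2 + 2 * inner ℝ (s - y) (w a • p a) + w a * ‖p a‖ ^ 2 := by
    intro a
    rw [show s + (p a - y) = (s - y) + p a by abel, norm_add_sq_real, inner_smul_right]
    ring
  have hsum : ∑ a, w a * ‖s + (p a - y)‖ ^ 2
      = ‖s‖ ^ 2 - ‖y‖ ^ 2 + ∑ a, w a * ‖p a‖ ^ 2 := by
    simp_rw [hexp, Finset.sum_add_distrib, ← Finset.mul_sum, ← Finset.sum_mul, hw1,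
      ← inner_sum, ← hy, norm_sub_sq_real, inner_sub_left, real_inner_self_eq_norm_sq]
    ring
  have hle : ∑ a, w a * ‖p a‖ ^ 2 ≤ δ ^ 2 := by
    calc ∑ a, w a * ‖p a‖ ^ 2 ≤ ∑ a, w a * δ ^ 2 := by
          gcongr with a _
          · exact hw a
          · exact hp a
      _ = δ ^ 2 := by rw [← Finset.sum_mul, hw1, one_mul]
  have hlow : ‖s‖ ^ 2 + δ ^ 2 < ∑ a, w a * ‖s + (p a - y)‖ ^ 2 := by
    calc ‖s‖ ^ 2 + δ ^ 2 = ∑ a, w a * (‖s‖ ^ 2 + δ ^ 2) := by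
          rw [← Finset.sum_mul, hw1, one_mul]
      _ < _ := by
        have hex : ∃ a, 0 < w a := by
          by_contra! h
          have : ∑ a, w a ≤ 0 := Finset.sum_nonpos fun a _ => h a
          linarith
        obtain ⟨a, ha⟩ := hex
        exact Finset.sum_lt_sum (fun b _ => mul_le_mul_of_nonneg_left (hlt b).le (hw b))
          ⟨a, Finset.mem_univ a, mul_lt_mul_of_pos_left (hlt a) ha⟩
  nlinarith [sq_nonneg ‖y‖]

theorem exists_norm_sum_sub_sq_le {A : Type*} [Fintype A] {w : A → ℝ} (hw : ∀ a, 0 ≤ w a)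
    (hw1 : ∑ a, w a = 1) {p : A → E} {δ : ℝ} (hp : ∀ a, ‖p a‖ ≤ δ) (m : ℕ) :
    ∃ f : Fin m → A, ‖∑ r, (p (f r) - ∑ b, w b • p b)‖ ^ 2 ≤ m * δ ^ 2 := by
  induction m with
  | zero => exact ⟨Fin.elim0, by simp⟩
  | succ m ih =>
    obtain ⟨f, hf⟩ := ih
    obtain ⟨a, ha⟩ := exists_norm_add_sub_sq_le hw hw1 hp (∑ r, (p (f r) - ∑ b, w b • p b))
    refine ⟨Fin.snoc f a, ?_⟩
    rw [Fin.sum_univ_castSucc]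
    simp only [Fin.snoc_castSucc, Fin.snoc_last]
    push_cast
    linarith

/-- Maurey's empirical method. -/
theorem exists_finset_absHull {ι : Type*} [Fintype ι] {x : ι → E} {δ N : ℝ}
    (hδ : ∀ i, ‖x i‖ ≤ δ) (hδ0 : 0 ≤ δ) (hN1 : 1 ≤ N) (hN : (Fintype.card ι : ℝ) ≤ N) {m : ℕ}
    (hm : 0 < m) :
    ∃ C : Finset E, (C.card : ℝ) ≤ Real.exp (m * Real.log (4 * N)) ∧
      (∀ c ∈ C, c ∈ Submodule.span ℝ (Set.range x)) ∧
      ∀ y ∈ absHull x, ∃ c ∈ C, ‖y - c‖ ≤ δ / Real.sqrt m := by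
  classical
  -- `none` stands for the zero vector, which receives the missing mass `1 - ∑ |β i|`; signs are
  -- moved from the coefficients to the vectors. There are `3 * card ι + 1 ≤ 4 * N` symbols.
  let val : Option (ι × SignType) → E := fun o => o.elim 0 fun q => (q.2 : ℝ) • x q.1
  let pt : (Fin m → Option (ι × SignType)) → E := fun c => (m : ℝ)⁻¹ • ∑ r, val (c r)
  have hm' : (0 : ℝ) < m := by exact_mod_cast hm
  refine ⟨Finset.univ.image pt, ?_, ?_, ?_⟩
  · calc ((Finset.univ.image pt).card : ℝ)
        ≤ (Fintype.card (Fin m → Option (ι × SignType)) : ℝ) := by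
          exact_mod_cast Finset.card_image_le
      _ = (3 * Fintype.card ι + 1 : ℝ) ^ m := by
          have : Fintype.card SignType = 3 := rfl
          simp only [Fintype.card_pi, Fintype.card_option, Fintype.card_prod, this,
            Finset.prod_const, Finset.card_univ, Fintype.card_fin]
          push_cast
          ring
      _ ≤ (4 * N) ^ m := by gcongr; linarith
      _ = _ := by rw [← Real.log_pow, Real.exp_log (by positivity)]
  · intro c hc
    obtain ⟨f, -, rfl⟩ := Finset.mem_image.1 hc
    refine Submodule.smul_mem _ _ (Submodule.sum_mem _ fun r _ => ?_)
    rcases h : f r with _ | q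
    · simp [val]
    · exact Submodule.smul_mem _ _ (Submodule.subset_span ⟨q.1, rfl⟩)
  · rintro y ⟨β, hβ, rfl⟩
    let code : Option ι → Option (ι × SignType) := fun o => o.map fun i => (i, SignType.sign (β i))
    let w : Option ι → ℝ := fun o => o.elim (1 - ∑ i, |β i|) fun i => |β i|
    have hw : ∀ a, 0 ≤ w a := by
      rintro (_ | i)
      · simpa [w] using hβ
      · simp [w]
    have hw1 : ∑ a, w a = 1 := by simp [Fintype.sum_option, w]
    have hp : ∀ a, ‖val (code a)‖ ≤ δ := by
      rintro (_ | i)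
      · simpa [val, code] using hδ0
      · simp only [val, code, Option.map_some, Option.elim_some, norm_smul]
        calc ‖((SignType.sign (β i) : SignType) : ℝ)‖ * ‖x i‖ ≤ 1 * δ := by
              refine mul_le_mul ?_ (hδ i) (norm_nonneg _) zero_le_one
              cases SignType.sign (β i) <;> simp
          _ = δ := one_mul _
    have hy : ∑ a, w a • val (code a) = ∑ i, β i • x i := by
      simp only [Fintype.sum_option, w, val, code, Option.map_none, Option.elim_none, smul_zero,
        zero_add, Option.map_some, Option.elim_some, smul_smul]
      exact Finset.sum_congr rfl fun i _ => by rw [abs_mul_sign]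
    obtain ⟨f, hf⟩ := exists_norm_sum_sub_sq_le hw hw1 hp m
    refine ⟨pt fun r => code (f r), Finset.mem_image_of_mem _ (Finset.mem_univ _), ?_⟩
    rw [hy, Finset.sum_sub_distrib, Finset.sum_const, Finset.card_univ, Fintype.card_fin,
      ← Nat.cast_smul_eq_nsmul ℝ] at hf
    have hpt : ∑ i, β i • x i - pt (fun r => code (f r))
        = -((m : ℝ)⁻¹ • (∑ r, val (code (f r)) - (m : ℝ) • ∑ i, β i • x i)) := by
      rw [smul_sub, smul_smul, inv_mul_cancel₀ hm'.ne', one_smul, neg_sub]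
    rw [hpt, norm_neg, norm_smul, norm_inv, Real.norm_natCast]
    have h1 : ‖∑ r, val (code (f r)) - (m : ℝ) • ∑ i, β i • x i‖ ≤ Real.sqrt m * δ := by
      refine abs_le_of_sq_le_sq' ?_ (by positivity) |>.2
      rw [mul_pow, Real.sq_sqrt hm'.le]
      exact hf
    calc (m : ℝ)⁻¹ * _ ≤ (m : ℝ)⁻¹ * (Real.sqrt m * δ) := by gcongr
      _ = δ / Real.sqrt m := by
        have : (m : ℝ) = Real.sqrt m * Real.sqrt m := (Real.mul_self_sqrt hm'.le).symm
        have h0 : Real.sqrt m ≠ 0 := (Real.sqrt_pos.2 hm').ne'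
        rw [this]
        field_simp
        simp

theorem hasCover_absHull {ι : Type*} [Fintype ι] {x : ι → E} {δ N : ℝ}
    (hδ : ∀ i, ‖x i‖ ≤ δ) (hδ0 : 0 ≤ δ) (hN1 : 1 ≤ N) (hN : (Fintype.card ι : ℝ) ≤ N) {m : ℕ}
    (hm : 0 < m) : HasCover (absHull x) (δ / Real.sqrt m) (m * Real.log (4 * N)) := by
  obtain ⟨C, hC, -, h⟩ := exists_finset_absHull hδ hδ0 hN1 hN hm
  exact ⟨C, hC, h⟩

/-- Maurey's centres lie in the span of the `x i`, so residuals remain in `U`. The volume bound then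
covers the residual ball of radius `δ / √m`, and the two costs add. -/
theorem hasCover_absHull_of_mem {ι : Type*} [Fintype ι] {x : ι → E} {δ N D : ℝ}
    (U : Submodule ℝ E) [FiniteDimensional ℝ U] (hU : ∀ i, x i ∈ U)
    (hδ : ∀ i, ‖x i‖ ≤ δ) (hδ0 : 0 < δ) (hN1 : 1 ≤ N) (hN : (Fintype.card ι : ℝ) ≤ N) {m : ℕ}
    (hm : 0 < m) (s : ℕ) (hD : (Module.finrank ℝ U : ℝ) ≤ D) :
    HasCover (absHull x) (δ / Real.sqrt m / 2 ^ s)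
      (m * Real.log (4 * N) + D * s * Real.log 5) := by
  obtain ⟨C, hC, hCU, h⟩ := exists_finset_absHull hδ hδ0.le hN1 hN hm
  have hm' : (0 : ℝ) < m := by exact_mod_cast hm
  have hspan : Submodule.span ℝ (Set.range x) ≤ U :=
    Submodule.span_le.2 (by rintro _ ⟨i, rfl⟩; exact hU i)
  have hsum := (show HasCover (C : Set E) 0 (m * Real.log (4 * N)) from
    ⟨C, hC, fun c hc => ⟨c, hc, by simp⟩⟩).add
      (hasCover_submodule_ball U (r := δ / Real.sqrt m) (by positivity) s hD)
      (U := absHull x) fun u hu => by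
        obtain ⟨c, hc, huc⟩ := h u hu
        refine ⟨c, hc, u - c, ⟨U.sub_mem ?_ (hspan (hCU c hc)), huc⟩, by abel⟩
        obtain ⟨β, -, rfl⟩ := hu
        exact U.sum_mem fun i _ => U.smul_mem _ (hU i)
  simpa using hsum

end Maurey

/-! ### Orthogonal increments and the hyperbolic cross -/

section Decomposition

variable {H : Type*} [NormedAddCommGroup H] [InnerProductSpace ℝ H]

/-- Decomposition of a vector into orthogonal increments along a nested sequence of subspaces,
truncated at `K`; the term with index `K + 1` is the remainder. -/
theorem exists_orthogonal_increments {𝒱 : ℕ → Submodule ℝ H} (hmono : Monotone 𝒱)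
    [∀ k, FiniteDimensional ℝ (𝒱 k)] {γ ρ : ℝ} (hγ : 0 < γ) (hρ : 0 < ρ) (hρ1 : ρ ≤ 1) {ψ : H}
    (hψ : ‖ψ‖ ≤ 1) (happ : ∀ k, 1 ≤ k → ∃ f ∈ 𝒱 k, ‖ψ - f‖ ≤ γ * ρ ^ k) (K : ℕ) :
    ∃ x : ℕ → H, ψ = ∑ k ∈ Finset.range (K + 2), x k ∧ (∀ k ≤ K, x k ∈ 𝒱 k) ∧
      (∀ k l, k ≠ l → inner ℝ (x k) (x l) = 0) ∧ ∀ k, ‖x k‖ ≤ (1 + γ) / ρ * ρ ^ k := by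
  -- Beyond `K` the approximation is `ψ` itself: increment `K + 1` is the whole remainder and all
  -- later ones vanish.
  let p : ℕ → H := fun k => if k ≤ K then (𝒱 k).starProjection ψ else ψ
  have hp : ∀ k ≤ K, p k ∈ 𝒱 k := fun k hk => by simp [p, hk]
  have hpK : ∀ k, K < k → p k = ψ := fun k hk => by simp [p, hk.not_ge]
  have he : ∀ k, ψ - p k ∈ (𝒱 k)ᗮ := fun k => by
    by_cases hk : k ≤ K
    · simp only [p, hk, if_true]
      exact Submodule.sub_starProjection_mem_orthogonal ψ
    · simp [hpK k (not_le.1 hk)]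
  have hemin : ∀ k ≤ K, ∀ f ∈ 𝒱 k, ‖ψ - p k‖ ≤ ‖ψ - f‖ := fun k hk f hf => by
    have h0 : inner ℝ (ψ - p k) (p k - f) = 0 :=
      Submodule.inner_left_of_mem_orthogonal (Submodule.sub_mem _ (hp k hk) hf) (he k)
    have h1 : ‖ψ - f‖ ^ 2 = ‖ψ - p k‖ ^ 2 + ‖p k - f‖ ^ 2 := by
      rw [show ψ - f = (ψ - p k) + (p k - f) by abel, norm_add_sq_real, h0]; ring
    refine abs_le_of_sq_le_sq' ?_ (norm_nonneg _) |>.2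
    nlinarith [sq_nonneg ‖p k - f‖]
  let x : ℕ → H := fun k => k.casesOn (p 0) fun l => p (l + 1) - p l
  have hx0 : x 0 = p 0 := rfl
  have hxs : ∀ l, x (l + 1) = p (l + 1) - p l := fun l => rfl
  have hxmem : ∀ k ≤ K, x k ∈ 𝒱 k := by
    rintro (_ | l) hk
    · exact hp 0 hk
    · rw [hxs]
      exact Submodule.sub_mem _ (hp _ hk) (hmono (Nat.le_succ l) (hp l (by omega)))
  have horth : ∀ k l, k < l → inner ℝ (x k) (x l) = 0 := by
    rintro k (_ | l) hkl
    · omega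
    by_cases hk : k ≤ K
    · refine Submodule.inner_right_of_mem_orthogonal (hmono (by omega : k ≤ l) (hxmem k hk)) ?_
      rw [hxs, show p (l + 1) - p l = (ψ - p l) - (ψ - p (l + 1)) by abel]
      exact Submodule.sub_mem _ (he l) (Submodule.orthogonal_le (hmono (Nat.le_succ l)) (he _))
    · rw [hxs, hpK l (by omega), hpK (l + 1) (by omega), sub_self, inner_zero_right]
  refine ⟨x, ?_, hxmem, ?_, ?_⟩
  · have : ∀ n, ∑ k ∈ Finset.range (n + 1), x k = p n := by
      intro n
      induction n with
      | zero => simp [hx0]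
      | succ n ih => rw [Finset.sum_range_succ, ih, hxs]; abel
    rw [this, hpK _ (by omega)]
  · intro k l hkl
    rcases lt_or_gt_of_ne hkl with h | h
    · exact horth k l h
    · rw [real_inner_comm]; exact horth l k h
  · rintro (_ | l)
    · have h1 : ‖p 0‖ ≤ 1 := by
        simp only [p, Nat.zero_le, if_true]
        exact (Submodule.norm_starProjection_apply_le _ _).trans hψ
      rw [hx0, pow_zero, mul_one]
      refine h1.trans ?_
      rw [le_div_iff₀ hρ]
      linarith
    -- The increment is bounded by the error one level below, whence the `1 / ρ`. At `l = 0` no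
    -- approximation rate is assumed and `‖ψ‖ ≤ 1` is used, whence `1 + γ`.
    · have hb : ‖x (l + 1)‖ ≤ (1 + γ) * ρ ^ l := by
        by_cases hl : l ≤ K
        · have h1 : ‖x (l + 1)‖ ≤ ‖ψ - p l‖ := by
            have h0 : inner ℝ (x (l + 1)) (ψ - p (l + 1)) = 0 := by
              by_cases hl1 : l + 1 ≤ K
              · exact Submodule.inner_right_of_mem_orthogonal (hxmem _ hl1) (he _)
              · rw [hpK (l + 1) (by omega), sub_self, inner_zero_right]
            have h1 : ‖ψ - p l‖ ^ 2 = ‖x (l + 1)‖ ^ 2 + ‖ψ - p (l + 1)‖ ^ 2 := by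
              rw [show ψ - p l = x (l + 1) + (ψ - p (l + 1)) by rw [hxs]; abel,
                norm_add_sq_real, h0]
              ring
            refine abs_le_of_sq_le_sq' ?_ (norm_nonneg _) |>.2
            nlinarith [sq_nonneg ‖ψ - p (l + 1)‖]
          refine h1.trans ?_
          have hρl : 0 < ρ ^ l := by positivity
          rcases Nat.eq_zero_or_pos l with rfl | hl0
          · have := hemin 0 hl 0 (Submodule.zero_mem _)
            rw [sub_zero] at this
            simp only [pow_zero, mul_one]
            linarith
          · obtain ⟨f, hf, hfl⟩ := happ l hl0
            have := hemin l hl f hf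
            nlinarith
        · rw [hxs, hpK l (by omega), hpK (l + 1) (by omega), sub_self, norm_zero]
          positivity
      refine hb.trans (le_of_eq ?_)
      rw [pow_succ]; field_simp

/-- The last `d - 1` coordinates are each at most `j`, and together with the sum they determine the
first. -/
theorem card_filter_sum_eq_le {d : ℕ} (hd : 1 ≤ d) (n j : ℕ) :
    ((Fintype.piFinset fun _ : Fin d => Finset.range n).filter fun k => ∑ i, k i = j).card
      ≤ (j + 1) ^ (d - 1) := by
  obtain ⟨d, rfl⟩ : ∃ e, d = e + 1 := ⟨d - 1, by omega⟩
  have hcard : (Fintype.piFinset fun _ : Fin d => Finset.range (j + 1)).card = (j + 1) ^ d := by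
    simp
  rw [Nat.add_sub_cancel, ← hcard]
  refine Finset.card_le_card_of_injOn (fun k i => k i.succ) ?_ ?_
  · intro k hk
    simp only [Finset.coe_filter, Set.mem_ofPred_eq, Fin.sum_univ_succ] at hk
    simp only [Finset.mem_coe, Fintype.mem_piFinset, Finset.mem_range]
    intro i
    have := Finset.single_le_sum (f := fun i : Fin d => k i.succ) (fun _ _ => Nat.zero_le _)
      (Finset.mem_univ i)
    omega
  · intro k hk l hl hkl
    simp only [Finset.coe_filter, Set.mem_ofPred_eq, Fin.sum_univ_succ] at hk hl
    have hs : ∀ i : Fin d, k i.succ = l i.succ := fun i => congrFun hkl i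
    have h0 : k 0 = l 0 := by
      have := hk.2.trans hl.2.symm
      simp only [hs] at this
      omega
    funext i
    exact Fin.cases h0 hs i

variable {E : Type*} [NormedAddCommGroup E] [InnerProductSpace ℝ E] {d : ℕ}

/-- Distinct multi-indices differ in some factor, where the increments are orthogonal; then
Pythagoras. Of the tensor product only multilinearity and the factorisation of inner products
matter. -/
theorem norm_sum_tensor_sq (T : MultilinearMap ℝ (fun _ : Fin d => H) E)
    (hT : ∀ f g, inner ℝ (T f) (T g) = ∏ i, inner ℝ (f i) (g i)) {x : Fin d → ℕ → H}
    (hx : ∀ i k l, k ≠ l → inner ℝ (x i k) (x i l) = 0) (S : Finset (Fin d → ℕ)) :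
    ‖∑ k ∈ S, T fun i => x i (k i)‖ ^ 2 = ∑ k ∈ S, ∏ i, ‖x i (k i)‖ ^ 2 := by
  rw [← real_inner_self_eq_norm_sq, sum_inner]
  refine Finset.sum_congr rfl fun k hk => ?_
  rw [inner_sum, Finset.sum_eq_single_of_mem k hk]
  · rw [hT]
    exact Finset.prod_congr rfl fun i _ => real_inner_self_eq_norm_sq _
  · intro l _ hlk
    obtain ⟨i, hi⟩ := Function.ne_iff.1 hlk
    rw [hT]
    exact Finset.prod_eq_zero (Finset.mem_univ i) (hx i _ _ hi.symm)

theorem norm_sum_tensor_sq_le (T : MultilinearMap ℝ (fun _ : Fin d => H) E)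
    (hT : ∀ f g, inner ℝ (T f) (T g) = ∏ i, inner ℝ (f i) (g i)) {x : Fin d → ℕ → H}
    (hx : ∀ i k l, k ≠ l → inner ℝ (x i k) (x i l) = 0) {C ρ : ℝ}
    (hxn : ∀ i k, ‖x i k‖ ≤ C * ρ ^ k) (S : Finset (Fin d → ℕ)) :
    ‖∑ k ∈ S, T fun i => x i (k i)‖ ^ 2 ≤ ∑ k ∈ S, C ^ (2 * d) * ρ ^ (2 * ∑ i, k i) := by
  rw [norm_sum_tensor_sq T hT hx]
  refine Finset.sum_le_sum fun k _ => ?_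
  calc ∏ i, ‖x i (k i)‖ ^ 2 ≤ ∏ i, (C * ρ ^ k i) ^ 2 := by
        refine Finset.prod_le_prod (fun i _ => by positivity) fun i _ => ?_
        gcongr
        exact hxn i _
    _ = C ^ (2 * d) * ρ ^ (2 * ∑ i, k i) := by
        rw [Finset.prod_pow, Finset.prod_mul_distrib, Finset.prod_const, Finset.card_univ,
          Fintype.card_fin, Finset.prod_pow_eq_pow_sum]
        ring

/-- A subspace of dimension at most the product of the dimensions that contains the tensors of
vectors from given subspaces. -/
theorem exists_finset_span_tensor (T : MultilinearMap ℝ (fun _ : Fin d => H) E)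
    {n : Fin d → ℕ} {V : Fin d → Submodule ℝ H} [∀ i, FiniteDimensional ℝ (V i)]
    (hV : ∀ i, Module.finrank ℝ (V i) = n i) :
    ∃ F : Finset E, F.card ≤ ∏ i, n i ∧
      ∀ x : Fin d → H, (∀ i, x i ∈ V i) → T x ∈ Submodule.span ℝ (F : Set E) := by
  classical
  let b : (i : Fin d) → Fin (n i) → H := fun i s => (Module.finBasisOfFinrankEq ℝ (V i) (hV i) s : H)
  refine ⟨Finset.univ.image fun σ : (i : Fin d) → Fin (n i) => T fun i => b i (σ i), ?_, ?_⟩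
  · refine Finset.card_image_le.trans ?_
    simp
  · intro x hx
    have hc : ∀ i, x i = ∑ s, (Module.finBasisOfFinrankEq ℝ (V i) (hV i)).repr ⟨x i, hx i⟩ s
        • b i s := by
      intro i
      have := congrArg Subtype.val
        ((Module.finBasisOfFinrankEq ℝ (V i) (hV i)).sum_repr ⟨x i, hx i⟩)
      rw [Submodule.coe_sum] at this
      exact this.symm
    have hx' : x = fun i => ∑ s, (Module.finBasisOfFinrankEq ℝ (V i) (hV i)).repr ⟨x i, hx i⟩ s
        • b i s := funext hc
    rw [hx']
    rw [T.map_sum]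
    refine Submodule.sum_mem _ fun σ _ => ?_
    rw [T.map_smul_univ]
    exact Submodule.smul_mem _ _ (Submodule.subset_span (by simp))

/-- Each multi-index on level `j` contributes dimension at most `∏ i, q * 2 ^ k i = q ^ d * 2 ^ j`.
-/
theorem exists_submodule_level (T : MultilinearMap ℝ (fun _ : Fin d => H) E) (hd : 1 ≤ d)
    {q : ℕ} {𝒱 : ℕ → Submodule ℝ H} [∀ k, FiniteDimensional ℝ (𝒱 k)]
    (hV : ∀ k, Module.finrank ℝ (𝒱 k) = q * 2 ^ k) (n j : ℕ) :
    ∃ U : Submodule ℝ E, FiniteDimensional ℝ U ∧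
      Module.finrank ℝ U ≤ (j + 1) ^ (d - 1) * (q ^ d * 2 ^ j) ∧
      ∀ k ∈ (Fintype.piFinset fun _ : Fin d => Finset.range n).filter (fun k => ∑ i, k i = j),
        ∀ x : Fin d → H, (∀ i, x i ∈ 𝒱 (k i)) → T x ∈ U := by
  classical
  choose F hF hFT using fun k : Fin d → ℕ =>
    exists_finset_span_tensor T (V := fun i => 𝒱 (k i)) (fun i => hV (k i))
  set S := (Fintype.piFinset fun _ : Fin d => Finset.range n).filter fun k => ∑ i, k i = j with hS
  refine ⟨Submodule.span ℝ (S.biUnion F : Finset E), FiniteDimensional.span_finset ℝ _, ?_, ?_⟩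
  · refine (finrank_span_finset_le_card _).trans (Finset.card_biUnion_le.trans ?_)
    calc ∑ k ∈ S, (F k).card ≤ ∑ k ∈ S, q ^ d * 2 ^ j := by
          refine Finset.sum_le_sum fun k hk => (hF k).trans (le_of_eq ?_)
          rw [Finset.prod_mul_distrib, Finset.prod_const, Finset.card_univ, Fintype.card_fin,
            Finset.prod_pow_eq_pow_sum, (Finset.mem_filter.1 hk).2]
      _ = S.card * (q ^ d * 2 ^ j) := by simp
      _ ≤ _ := Nat.mul_le_mul_right _ (card_filter_sum_eq_le hd n j)
  · intro k hk x hx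
    refine Submodule.span_mono ?_ (hFT k x hx)
    exact_mod_cast Finset.subset_biUnion_of_mem F hk

/-- Hyperbolic cross decomposition of elementary tensors. -/
theorem exists_hyperbolic_decomposition {Θ : Type*}
    (T : MultilinearMap ℝ (fun _ : Fin d => H) E)
    (hT : ∀ f g, inner ℝ (T f) (T g) = ∏ i, inner ℝ (f i) (g i)) (hd : 1 ≤ d)
    {q : ℕ} {𝒱 : ℕ → Submodule ℝ H} (hmono : Monotone 𝒱) [∀ k, FiniteDimensional ℝ (𝒱 k)]
    (hV : ∀ k, Module.finrank ℝ (𝒱 k) = q * 2 ^ k) {γ ρ : ℝ} (hγ : 0 < γ) (hρ : 0 < ρ)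
    (hρ1 : ρ < 1) {ψ : Θ → H} (hψ : ∀ v, ‖ψ v‖ ≤ 1)
    (happ : ∀ k, 1 ≤ k → ∀ v, ∃ f ∈ 𝒱 k, ‖ψ v - f‖ ≤ γ * ρ ^ k) (K : ℕ) :
    ∃ (r : ℕ → (Fin d → Θ) → E) (U : ℕ → Submodule ℝ E),
      (∀ v, T (fun i => ψ (v i)) = ∑ j ∈ Finset.range (K + 2), r j v) ∧
      (∀ j, FiniteDimensional ℝ (U j)) ∧
      (∀ j, Module.finrank ℝ (U j) ≤ (j + 1) ^ (d - 1) * (q ^ d * 2 ^ j)) ∧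
      (∀ j ≤ K, ∀ v, r j v ∈ U j) ∧
      (∀ j ≤ K, ∀ v, ‖r j v‖ ^ 2
        ≤ (j + 1) ^ (d - 1) * (((1 + γ) / ρ) ^ (2 * d) * (ρ ^ 2) ^ j)) ∧
      ∀ v, ‖r (K + 1) v‖ ^ 2 ≤ (d * (K + 1) + 1) ^ (d - 1) * (((1 + γ) / ρ) ^ (2 * d) *
        ((ρ ^ 2) ^ K / (1 - ρ ^ 2))) := by
  classical
  choose x hxsum hxmem hxorth hxn using fun v =>
    exists_orthogonal_increments hmono hγ hρ hρ1.le (hψ v) (fun k hk => happ k hk v) K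
  choose U hUfin hUrank hUmem using fun j => exists_submodule_level T hd hV (K + 2) j
  set B := Fintype.piFinset fun _ : Fin d => Finset.range (K + 2) with hB
  set C := (1 + γ) / ρ with hC
  have hρ2 : ρ ^ 2 < 1 := by nlinarith
  have hρ20 : 0 < ρ ^ 2 := by positivity
  let t : (Fin d → Θ) → (Fin d → ℕ) → E := fun v k => T fun i => x (v i) (k i)
  let r : ℕ → (Fin d → Θ) → E := fun j v =>
    if j ≤ K then ∑ k ∈ B.filter fun k => ∑ i, k i = j, t v k
    else ∑ k ∈ B.filter fun k => K < ∑ i, k i, t v k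
  have hle : ∀ (v : Fin d → Θ) (S : Finset (Fin d → ℕ)),
      ‖∑ k ∈ S, t v k‖ ^ 2 ≤ ∑ k ∈ S, C ^ (2 * d) * ρ ^ (2 * ∑ i, k i) := fun v S =>
    norm_sum_tensor_sq_le T hT (x := fun i => x (v i)) (fun i => hxorth (v i))
      (fun i => hxn (v i)) S
  have hlevel : ∀ j, ∑ k ∈ B.filter (fun k => ∑ i, k i = j), C ^ (2 * d) * ρ ^ (2 * ∑ i, k i)
      ≤ (j + 1) ^ (d - 1) * (C ^ (2 * d) * (ρ ^ 2) ^ j) := by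
    intro j
    calc _ = ∑ k ∈ B.filter (fun k => ∑ i, k i = j), C ^ (2 * d) * (ρ ^ 2) ^ j := by
          refine Finset.sum_congr rfl fun k hk => ?_
          rw [(Finset.mem_filter.1 hk).2, pow_mul ρ 2 j]
      _ = (B.filter (fun k => ∑ i, k i = j)).card * (C ^ (2 * d) * (ρ ^ 2) ^ j) := by simp
      _ ≤ _ := by
        refine mul_le_mul_of_nonneg_right ?_ (by positivity)
        exact_mod_cast card_filter_sum_eq_le hd (K + 2) j
  refine ⟨r, U, ?_, hUfin, hUrank, ?_, ?_, ?_⟩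
  · intro v
    have h1 : T (fun i => ψ (v i)) = ∑ k ∈ B, t v k := by
      have : (fun i => ψ (v i)) = fun i => ∑ k ∈ Finset.range (K + 2), x (v i) k :=
        funext fun i => hxsum (v i)
      rw [this, T.map_sum_finset]
    have h2 : ∑ j ∈ Finset.range (K + 1), r j v
        = ∑ k ∈ B.filter fun k => ¬ K < ∑ i, k i, t v k := by
      rw [← Finset.sum_fiberwise_of_maps_to (s := B.filter fun k => ¬ K < ∑ i, k i)
        (t := Finset.range (K + 1)) (g := fun k => ∑ i, k i)]
      · refine Finset.sum_congr rfl fun j hj => ?_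
        have hj' : j ≤ K := by simpa [Nat.lt_succ_iff] using hj
        simp only [r, hj', if_true]
        refine Finset.sum_congr ?_ fun _ _ => rfl
        ext k
        simp only [Finset.mem_filter]
        constructor
        · rintro ⟨h, h'⟩; exact ⟨⟨h, by omega⟩, h'⟩
        · rintro ⟨⟨h, -⟩, h'⟩; exact ⟨h, h'⟩
      · intro k hk
        have := (Finset.mem_filter.1 hk).2
        simp only [Finset.mem_range]; omega
    rw [Finset.sum_range_succ, h2, h1]
    simp only [r, show ¬ (K + 1 ≤ K) by omega, if_false]
    rw [add_comm, Finset.sum_filter_add_sum_filter_not]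
  · intro j hj v
    simp only [r, hj, if_true]
    -- On levels `j ≤ K` every `k i ≤ K`, so the remainder increment `K + 1`, which lies in no `𝒱
    -- k`, does not occur.
    refine Submodule.sum_mem _ fun k hk => hUmem j k hk _ fun i => hxmem _ _ ?_
    have h1 := (Finset.mem_filter.1 hk).2
    have h2 := Finset.single_le_sum (f := k) (fun _ _ => Nat.zero_le _) (Finset.mem_univ i)
    omega
  · intro j hj v
    simp only [r, hj, if_true]
    exact (hle v _).trans (hlevel j)
  · intro v
    simp only [r, show ¬ (K + 1 ≤ K) by omega, if_false]
    refine (hle v _).trans ?_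
    -- Each index is at most `K + 1`, so tail levels end at `d * (K + 1)`. The polynomial factor is
    -- bounded by its largest value and the rest is a geometric series.
    rw [← Finset.sum_fiberwise_of_maps_to (t := Finset.Ico (K + 1) (d * (K + 1) + 1))
      (g := fun k => ∑ i, k i)]
    · calc _ ≤ ∑ j ∈ Finset.Ico (K + 1) (d * (K + 1) + 1),
            ((d : ℝ) * (K + 1) + 1) ^ (d - 1) * (C ^ (2 * d) * (ρ ^ 2) ^ j) := by
            refine Finset.sum_le_sum fun j hj => ?_
            have hj' := (Finset.mem_Ico.1 hj).2
            refine le_trans ?_ ((hlevel j).trans ?_)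
            · refine Finset.sum_le_sum_of_subset_of_nonneg ?_ fun _ _ _ => by positivity
              intro k hk
              simp only [Finset.mem_filter] at hk ⊢
              exact ⟨hk.1.1, hk.2⟩
            · refine mul_le_mul_of_nonneg_right ?_ (by positivity)
              have : (j : ℝ) + 1 ≤ (d : ℝ) * (K + 1) + 1 := by
                have : j ≤ d * (K + 1) := by omega
                have : (j : ℝ) ≤ d * (K + 1) := by exact_mod_cast this
                linarith
              gcongr
        _ = ((d : ℝ) * (K + 1) + 1) ^ (d - 1) * (C ^ (2 * d) *
            ∑ j ∈ Finset.Ico (K + 1) (d * (K + 1) + 1), (ρ ^ 2) ^ j) := by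
            simp only [Finset.mul_sum]
        _ ≤ _ := by
            gcongr
            refine (geom_sum_Ico_le_of_lt_one hρ20.le hρ2).trans ?_
            have : (ρ ^ 2) ^ (K + 1) ≤ (ρ ^ 2) ^ K :=
              pow_le_pow_of_le_one hρ20.le hρ2.le (Nat.le_succ K)
            have : 0 < 1 - ρ ^ 2 := by linarith
            gcongr
    · intro k hk
      obtain ⟨hk1, hk2⟩ := Finset.mem_filter.1 hk
      have : ∑ i, k i ≤ ∑ _i : Fin d, (K + 1) := Finset.sum_le_sum fun i _ => by
        have := Finset.mem_range.1 ((Fintype.mem_piFinset.1 hk1) i)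
        omega
      simp only [Finset.sum_const, Finset.card_univ, Fintype.card_fin, smul_eq_mul] at this
      simp only [Finset.mem_Ico]
      omega

end Decomposition

/-! ### Elementary tensors in `L₂` -/

section LpTensor

theorem norm_sub_sq_Lp_two (μ : Measure ℝ) (f g : Lp ℝ 2 μ) : ‖f - g‖ ^ 2 = ∫ u, (f u - g u) ^ 2 ∂μ := by
  rw [← real_inner_self_eq_norm_sq, L2.inner_def]
  refine integral_congr_ae ?_
  filter_upwards [Lp.coeFn_sub f g] with u h
  rw [h]
  simp [pow_two]

theorem prod_update_eval {μ : Measure ℝ} {d : ℕ} [DecidableEq (Fin d)] (f : Fin d → Lp ℝ 2 μ) (i : Fin d) (z : Lp ℝ 2 μ)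
    (u : Fin d → ℝ) : ∏ j, (Function.update f i z j) (u j)
      = z (u i) * ∏ j ∈ Finset.univ.erase i, f j (u j) := by
  rw [← Finset.mul_prod_erase _ _ (Finset.mem_univ i), Function.update_self]
  congr 1
  exact Finset.prod_congr rfl fun j hj => by
    rw [Function.update_of_ne (Finset.ne_of_mem_erase hj)]

variable (μ : Measure ℝ) [SigmaFinite μ] {d : ℕ}

theorem coeFn_tensor (f : Fin d → Lp ℝ 2 μ) :
    tensor μ f =ᵐ[Measure.pi fun _ : Fin d => μ] fun u => ∏ i, f i (u i) :=
  MemLp.coeFn_toLp _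

variable {μ} in
theorem ae_pi_eval {p : ℝ → Prop} (h : ∀ᵐ x ∂μ, p x) (i : Fin d) :
    ∀ᵐ u ∂(Measure.pi fun _ : Fin d => μ), p (u i) :=
  (Measure.quasiMeasurePreserving_eval (fun _ : Fin d => μ) i).ae h

theorem tensor_update_add [DecidableEq (Fin d)] (f : Fin d → Lp ℝ 2 μ) (i : Fin d)
    (x y : Lp ℝ 2 μ) : tensor μ (Function.update f i (x + y))
      = tensor μ (Function.update f i x) + tensor μ (Function.update f i y) := by
  apply Lp.ext
  filter_upwards [coeFn_tensor μ (Function.update f i (x + y)),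
    coeFn_tensor μ (Function.update f i x), coeFn_tensor μ (Function.update f i y),
    Lp.coeFn_add (tensor μ (Function.update f i x)) (tensor μ (Function.update f i y)),
    ae_pi_eval (Lp.coeFn_add x y) i] with u h1 h2 h3 h4 h5
  rw [h4, Pi.add_apply, h1, h2, h3, prod_update_eval, prod_update_eval, prod_update_eval, h5,
    Pi.add_apply, add_mul]

theorem tensor_update_smul [DecidableEq (Fin d)] (f : Fin d → Lp ℝ 2 μ) (i : Fin d) (c : ℝ)
    (x : Lp ℝ 2 μ) :
    tensor μ (Function.update f i (c • x)) = c • tensor μ (Function.update f i x) := by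
  apply Lp.ext
  filter_upwards [coeFn_tensor μ (Function.update f i (c • x)),
    coeFn_tensor μ (Function.update f i x),
    Lp.coeFn_smul c (tensor μ (Function.update f i x)),
    ae_pi_eval (Lp.coeFn_smul c x) i] with u h1 h2 h4 h5
  rw [h4, Pi.smul_apply, h1, h2, prod_update_eval, prod_update_eval, h5, Pi.smul_apply,
    smul_eq_mul, smul_eq_mul, mul_assoc]

/-- The elementary tensor as a multilinear map. -/
noncomputable def tensorMap (d : ℕ) : MultilinearMap ℝ (fun _ : Fin d => Lp ℝ 2 μ)
    (Lp ℝ 2 (Measure.pi fun _ : Fin d => μ)) where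
  toFun := tensor μ
  map_update_add' := tensor_update_add μ
  map_update_smul' := tensor_update_smul μ

theorem inner_tensor (f g : Fin d → Lp ℝ 2 μ) :
    inner ℝ (tensor μ f) (tensor μ g) = ∏ i, inner ℝ (f i) (g i) := by
  simp only [L2.inner_def]
  rw [← integral_fintype_prod_eq_prod (μ := fun _ => μ)
    (f := fun i (x : ℝ) => inner ℝ (f i x) (g i x))]
  refine integral_congr_ae ?_
  filter_upwards [coeFn_tensor μ f, coeFn_tensor μ g] with u h1 h2
  rw [h1, h2]
  simp [Finset.prod_mul_distrib]

end LpTensor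

/-! ### Replacing factors by members of a net -/

section TensorNorm

variable {H E : Type*} [NormedAddCommGroup H] [InnerProductSpace ℝ H]
  [NormedAddCommGroup E] [InnerProductSpace ℝ E] {d : ℕ}

theorem norm_tensor (T : MultilinearMap ℝ (fun _ : Fin d => H) E)
    (hT : ∀ f g, inner ℝ (T f) (T g) = ∏ i, inner ℝ (f i) (g i)) (f : Fin d → H) :
    ‖T f‖ = ∏ i, ‖f i‖ := by
  have h : ‖T f‖ ^ 2 = (∏ i, ‖f i‖) ^ 2 := by
    rw [← real_inner_self_eq_norm_sq, hT, ← Finset.prod_pow]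
    exact Finset.prod_congr rfl fun i _ => real_inner_self_eq_norm_sq _
  exact (pow_left_inj₀ (norm_nonneg _) (Finset.prod_nonneg fun i _ => norm_nonneg _)
    two_ne_zero).1 h

theorem norm_tensor_sub_le (T : MultilinearMap ℝ (fun _ : Fin d => H) E)
    (hT : ∀ f g, inner ℝ (T f) (T g) = ∏ i, inner ℝ (f i) (g i)) {f g : Fin d → H} {η : ℝ}
    (hf : ∀ i, ‖f i‖ ≤ 1) (hg : ∀ i, ‖g i‖ ≤ 1) (hfg : ∀ i, ‖f i - g i‖ ≤ η) :
    ‖T f - T g‖ ≤ d * η := by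
  rcases Nat.eq_zero_or_pos d with rfl | hd
  · simp [Subsingleton.elim f g]
  have hη : 0 ≤ η := (norm_nonneg _).trans (hfg ⟨0, hd⟩)
  have hb : ∀ m, ‖T m‖ ≤ 1 * ∏ i, ‖m i‖ := fun m => by rw [norm_tensor T hT, one_mul]
  have h := T.norm_image_sub_le_of_bound zero_le_one hb f g
  refine h.trans ?_
  have h1 : max ‖f‖ ‖g‖ ≤ 1 :=
    max_le ((pi_norm_le_iff_of_nonneg zero_le_one).2 hf) ((pi_norm_le_iff_of_nonneg zero_le_one).2 hg)
  have h2 : ‖f - g‖ ≤ η := (pi_norm_le_iff_of_nonneg hη).2 hfg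
  have h3 : max ‖f‖ ‖g‖ ^ (Fintype.card (Fin d) - 1) ≤ 1 := pow_le_one₀ (by positivity) h1
  calc 1 * (Fintype.card (Fin d) : ℝ) * max ‖f‖ ‖g‖ ^ (Fintype.card (Fin d) - 1) * ‖f - g‖
      ≤ 1 * (Fintype.card (Fin d) : ℝ) * 1 * η := by gcongr
    _ = d * η := by simp

/-- Replacing each factor by a nearby member of a finite subfamily. -/
theorem exists_absHull_tensor_near {Θ : Type*} (T : MultilinearMap ℝ (fun _ : Fin d => H) E)
    (hT : ∀ f g, inner ℝ (T f) (T g) = ∏ i, inner ℝ (f i) (g i)) {ψ : Θ → H}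
    (hψ : ∀ v, ‖ψ v‖ ≤ 1) {S : Finset Θ} {η : ℝ} (hη : 0 ≤ η)
    (hS : ∀ v, ∃ s ∈ S, ‖ψ v - ψ s‖ ≤ η)
    (A : Finset (Fin d → Θ)) (β : (Fin d → Θ) → ℝ) (hβ : ∑ v ∈ A, |β v| ≤ 1) :
    ∃ y ∈ absHull (fun s : Fin d → S => T fun i => ψ (s i)),
      ‖∑ v ∈ A, β v • T (fun i => ψ (v i)) - y‖ ≤ d * η := by
  classical
  choose π hπS hπ using hS
  let c : (Fin d → Θ) → Fin d → S := fun v i => ⟨π (v i), hπS _⟩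
  -- Coefficients of tensors rounded to the same net point are added, which cannot increase the
  -- total mass.
  refine ⟨∑ s, (∑ v ∈ A with c v = s, β v) • T fun i => ψ (s i), ⟨_, ?_, rfl⟩, ?_⟩
  · calc ∑ s, |∑ v ∈ A with c v = s, β v| ≤ ∑ s, ∑ v ∈ A with c v = s, |β v| :=
          Finset.sum_le_sum fun s _ => Finset.abs_sum_le_sum_abs _ _
      _ = ∑ v ∈ A, |β v| := Finset.sum_fiberwise A c _
      _ ≤ 1 := hβ
  · have h1 : ∑ s, (∑ v ∈ A with c v = s, β v) • T (fun i => ψ (s i))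
        = ∑ v ∈ A, β v • T fun i => ψ (c v i) := by
      rw [← Finset.sum_fiberwise A c]
      refine Finset.sum_congr rfl fun s _ => ?_
      rw [Finset.sum_smul]
      exact Finset.sum_congr rfl fun v hv => by rw [(Finset.mem_filter.1 hv).2]
    rw [h1, ← Finset.sum_sub_distrib]
    calc ‖∑ v ∈ A, (β v • T (fun i => ψ (v i)) - β v • T fun i => ψ (c v i))‖
        ≤ ∑ v ∈ A, |β v| * (d * η) := by
          refine norm_sum_le_of_le _ fun v _ => ?_
          rw [← smul_sub, norm_smul, Real.norm_eq_abs]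
          refine mul_le_mul_of_nonneg_left ?_ (abs_nonneg _)
          exact norm_tensor_sub_le T hT (fun i => hψ _) (fun i => hψ _) fun i => hπ _
      _ ≤ 1 * (d * η) := by rw [← Finset.sum_mul]; gcongr
      _ = d * η := one_mul _

end TensorNorm

/-! ### Geometric sums over levels -/

section LevelSums

/-- The total refinement cost: the weight `K - j` is absorbed by the decay of `2 ^ j` below `K`, so
no extra logarithm appears. -/
theorem sum_two_pow_mul_sub_le (K : ℕ) :
    ∑ j ∈ Finset.range (K + 1), (2 : ℝ) ^ j * ((K - j : ℕ) : ℝ) ≤ 2 * 2 ^ K := by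
  have h : ∀ K : ℕ, ∑ j ∈ Finset.range (K + 1), 2 ^ j * (K - j) + K + 2 = 2 ^ (K + 1) := by
    intro K
    induction K with
    | zero => simp
    | succ K ih =>
      have h1 : ∑ j ∈ Finset.range (K + 1), 2 ^ j * (K + 1 - j)
          = ∑ j ∈ Finset.range (K + 1), 2 ^ j * (K - j) + ∑ j ∈ Finset.range (K + 1), 2 ^ j := by
        rw [← Finset.sum_add_distrib]
        refine Finset.sum_congr rfl fun j hj => ?_
        have : K + 1 - j = K - j + 1 := by have := Finset.mem_range.1 hj; omega
        rw [this, mul_add, mul_one]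
      have h2 : ∑ j ∈ Finset.range (K + 1), 2 ^ j + 1 = 2 ^ (K + 1) := by
        rw [Nat.geomSum_eq le_rfl]
        have : 1 ≤ 2 ^ (K + 1) := Nat.one_le_two_pow
        simp only [Nat.add_one_sub_one, Nat.div_one]
        omega
      rw [Finset.sum_range_succ, h1, Nat.sub_self, mul_zero, pow_succ]
      omega
  have h' := h K
  rw [pow_succ] at h'
  have h'' : ∑ j ∈ Finset.range (K + 1), 2 ^ j * (K - j) ≤ 2 * 2 ^ K := by omega
  exact_mod_cast h''

theorem sum_two_pow_le (K : ℕ) : ∑ j ∈ Finset.range (K + 1), (2 : ℝ) ^ j ≤ 2 * 2 ^ K := by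
  rw [geom_sum_eq (by norm_num)]
  rw [pow_succ]
  linarith

theorem mul_succ_le_two_pow (K : ℕ) : (K : ℝ) * (K + 1) ≤ 4 * 2 ^ K := by
  -- The added `2 * K + 4` is what the induction step needs, as the left side grows by exactly that
  -- amount.
  have h : ∀ K : ℕ, K * (K + 1) + 2 * K + 4 ≤ 4 * 2 ^ K := by
    intro K
    induction K with
    | zero => simp
    | succ K ih => rw [pow_succ]; nlinarith
  have : K * (K + 1) ≤ 4 * 2 ^ K := by have := h K; omega
  exact_mod_cast this

theorem sum_half_pow_le (K : ℕ) :
    ∑ j ∈ Finset.range (K + 1), (1 / 2 : ℝ) ^ (K - j) ≤ 2 := by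
  have h := Finset.sum_range_reflect (fun j => (1 / 2 : ℝ) ^ j) (K + 1)
  simp only [Nat.add_sub_cancel] at h
  have h2 := geom_sum_Ico_le_of_lt_one (x := (1 / 2 : ℝ)) (m := 0) (n := K + 1) (by norm_num)
    (by norm_num)
  rw [h, Finset.range_eq_Ico]
  refine h2.trans (by norm_num)

end LevelSums

/-! ### Covering the hull at a fixed truncation level -/

section FixedLevel

variable {H E : Type*} [NormedAddCommGroup H] [InnerProductSpace ℝ H]
  [NormedAddCommGroup E] [InnerProductSpace ℝ E] {d : ℕ}

/-- One coefficient vector serves all levels, so the hull of a sum lies in the sum of the hulls. -/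
theorem absHull_subset_sum {ι : Type*} [Fintype ι] {t : ι → E} {r : ℕ → ι → E} {n : ℕ}
    (h : ∀ v, t v = ∑ j ∈ Finset.range (n + 1), r j v) {u : E} (hu : u ∈ absHull t) :
    ∃ x ∈ {u | ∃ x : ℕ → E, (∀ j < n, x j ∈ absHull (r j)) ∧ u = ∑ j ∈ Finset.range n, x j},
      ∃ y ∈ absHull (r n), u = x + y := by
  obtain ⟨β, hβ, rfl⟩ := hu
  refine ⟨_, ⟨fun j => ∑ v, β v • r j v, fun j _ => ⟨β, hβ, rfl⟩, rfl⟩, _, ⟨β, hβ, rfl⟩, ?_⟩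
  rw [← Finset.sum_range_succ (fun j => ∑ v, β v • r j v), Finset.sum_comm]
  refine Finset.sum_congr rfl fun v _ => ?_
  rw [h, Finset.smul_sum]

/-- The number of terms used in the empirical approximation at a given level. -/
theorem ceil_level_bounds {M K : ℝ} (hM : 1 ≤ M) (hK : 1 ≤ K) {G ρ : ℝ} (hG : 0 ≤ G)
    (hρ : 0 ≤ ρ) (j : ℕ) :
    0 < ⌈2 ^ j * M / K⌉₊ ∧ (⌈2 ^ j * M / K⌉₊ : ℝ) * K ≤ 2 ^ j * M + K ∧
      G * Real.sqrt M * ρ ^ j / Real.sqrt ⌈2 ^ j * M / K⌉₊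
        ≤ G * Real.sqrt K * (ρ / Real.sqrt 2) ^ j := by
  have hpos : 0 < 2 ^ j * M / K := by positivity
  have hceil : 0 < ⌈2 ^ j * M / K⌉₊ := Nat.ceil_pos.2 hpos
  refine ⟨hceil, ?_, ?_⟩
  · have h1 := (Nat.ceil_lt_add_one hpos.le).le
    calc (⌈2 ^ j * M / K⌉₊ : ℝ) * K ≤ (2 ^ j * M / K + 1) * K := by gcongr
      _ = _ := by field_simp
  · have h1 : Real.sqrt (2 ^ j * M / K) ≤ Real.sqrt ⌈2 ^ j * M / K⌉₊ :=
      Real.sqrt_le_sqrt (Nat.le_ceil _)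
    have h2 : Real.sqrt (2 ^ j * M / K) = Real.sqrt 2 ^ j * Real.sqrt M / Real.sqrt K := by
      have hs : Real.sqrt (2 ^ j) = Real.sqrt 2 ^ j := by
        rw [Real.sqrt_eq_iff_mul_self_eq (by positivity) (by positivity), ← mul_pow,
          Real.mul_self_sqrt (by norm_num)]
      rw [Real.sqrt_div (by positivity), Real.sqrt_mul (by positivity), hs]
    have hM0 : 0 < Real.sqrt M := Real.sqrt_pos.2 (by linarith)
    have hK0 : 0 < Real.sqrt K := Real.sqrt_pos.2 (by linarith)
    calc G * Real.sqrt M * ρ ^ j / Real.sqrt ⌈2 ^ j * M / K⌉₊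
        ≤ G * Real.sqrt M * ρ ^ j / (Real.sqrt 2 ^ j * Real.sqrt M / Real.sqrt K) := by
          rw [← h2]
          have : 0 < Real.sqrt (2 ^ j * M / K) := Real.sqrt_pos.2 hpos
          gcongr
      _ = _ := by rw [div_pow]; field_simp

theorem exists_hasCover_absHull_tensor {Θ : Type*}
    (T : MultilinearMap ℝ (fun _ : Fin d => H) E)
    (hT : ∀ f g, inner ℝ (T f) (T g) = ∏ i, inner ℝ (f i) (g i)) (hd : 1 ≤ d)
    {q : ℕ} {𝒱 : ℕ → Submodule ℝ H} (hmono : Monotone 𝒱) [∀ k, FiniteDimensional ℝ (𝒱 k)]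
    (hV : ∀ k, Module.finrank ℝ (𝒱 k) = q * 2 ^ k) {γ ρ : ℝ} (hγ : 0 < γ) (hρ : 0 < ρ)
    (hρ1 : ρ < 1) {ψ : Θ → H} (hψ : ∀ v, ‖ψ v‖ ≤ 1)
    (happ : ∀ k, 1 ≤ k → ∀ v, ∃ f ∈ 𝒱 k, ‖ψ v - f‖ ≤ γ * ρ ^ k) {c : ℝ} (hc : 0 ≤ c) :
    ∃ G B : ℝ, 0 < G ∧ 0 ≤ B ∧ ∀ K : ℕ, 1 ≤ K → ∀ S : Finset Θ, S.Nonempty →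
      Real.log (4 * (S.card : ℝ) ^ d) ≤ c * K →
      HasCover (absHull fun s : Fin d → S => T fun i => ψ (s i))
        (G * Real.sqrt K * (ρ / Real.sqrt 2) ^ K) (B * 2 ^ K * (K : ℝ) ^ (d - 1)) := by
  set τ := ρ / Real.sqrt 2 with hτ
  have hτ0 : 0 < τ := by positivity
  have hρ2 : 0 < 1 - ρ ^ 2 := by nlinarith
  -- `A` halvings gain a factor `τ / 2`; hence `A * (K - j)` of them take radius `τ ^ j` to at most
  -- `τ ^ K / 2 ^ (K - j)`.
  obtain ⟨A, hA⟩ : ∃ A : ℕ, 2 / τ ≤ 2 ^ A := by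
    obtain ⟨A, hA⟩ := pow_unbounded_of_one_lt (2 / τ) (one_lt_two)
    exact ⟨A, hA.le⟩
  set C := (1 + γ) / ρ with hC
  have hC0 : 0 < C := by positivity
  have hd' : (1 : ℝ) ≤ d := by exact_mod_cast hd
  -- For `K ≥ 1`, both `j + 1` with `j ≤ K` and `d * (K + 1) + 1` are at most `3 * d * K`.
  set P : ℝ := (3 * d) ^ (d - 1) with hP
  have hP0 : 0 < P := by positivity
  set G := Real.sqrt (P * C ^ (2 * d) / (1 - ρ ^ 2)) with hG
  have hG0 : 0 < G := Real.sqrt_pos.2 (by positivity)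
  have hG2 : G ^ 2 = P * C ^ (2 * d) / (1 - ρ ^ 2) := Real.sq_sqrt (by positivity)
  have hlog5 : 0 ≤ Real.log 5 := Real.log_nonneg (by norm_num)
  -- Radius: `2 * G` from the levels and `G` from the tail. In the cost, `8 * c` pays for the Maurey
  -- draws and the rest for the refinements.
  refine ⟨3 * G, 8 * c + 2 * (P * q ^ d * A * Real.log 5), by positivity, by positivity, ?_⟩
  intro K hK S hS hlog
  have hK' : (1 : ℝ) ≤ K := by exact_mod_cast hK
  set M : ℝ := (K : ℝ) ^ (d - 1) with hM
  have hM1 : 1 ≤ M := one_le_pow₀ hK'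
  have hPM : P * M = (3 * d * K : ℝ) ^ (d - 1) := by rw [hP, hM, ← mul_pow]
  obtain ⟨r, U, hsum, hUfin, hUrank, hUmem, hrn, hrtail⟩ :=
    exists_hyperbolic_decomposition T hT hd hmono hV hγ hρ hρ1 hψ happ K
  set N : ℝ := (S.card : ℝ) ^ d with hN
  have hN1 : 1 ≤ N := one_le_pow₀ (by exact_mod_cast hS.card_pos)
  have hcard : (Fintype.card (Fin d → S) : ℝ) ≤ N := by simp [hN]
  have hm := fun j => ceil_level_bounds hM1 hK' hG0.le hρ.le j
  have hnorm_le : ∀ {a : E} {j : ℕ}, ‖a‖ ^ 2 ≤ G ^ 2 * M * (ρ ^ 2) ^ j →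
      ‖a‖ ≤ G * Real.sqrt M * ρ ^ j := by
    intro a j h
    refine abs_le_of_sq_le_sq' ?_ (by positivity) |>.2
    calc ‖a‖ ^ 2 ≤ G ^ 2 * M * (ρ ^ 2) ^ j := h
      _ = G ^ 2 * Real.sqrt M ^ 2 * (ρ ^ 2) ^ j := by
        rw [Real.sq_sqrt (show (0 : ℝ) ≤ M by linarith)]
      _ = (G * Real.sqrt M * ρ ^ j) ^ 2 := by ring
  have hjK : ∀ j ≤ K, ((j : ℝ) + 1) ^ (d - 1) ≤ P * M := by
    intro j hj
    rw [hPM]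
    have : (j : ℝ) ≤ K := by exact_mod_cast hj
    gcongr
    nlinarith
  have hlev : ∀ j ≤ K, ∀ v, ‖r j v‖ ≤ G * Real.sqrt M * ρ ^ j := by
    intro j hj v
    refine hnorm_le ((hrn j hj v).trans ?_)
    rw [hG2]
    calc ((j : ℝ) + 1) ^ (d - 1) * (C ^ (2 * d) * (ρ ^ 2) ^ j)
        ≤ P * M * (C ^ (2 * d) * (ρ ^ 2) ^ j) := by gcongr; exact hjK j hj
      _ = P * C ^ (2 * d) * (M * (ρ ^ 2) ^ j) := by ring
      _ ≤ P * C ^ (2 * d) / (1 - ρ ^ 2) * (M * (ρ ^ 2) ^ j) := by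
        gcongr
        rw [le_div_iff₀ hρ2]
        have : 0 < P * C ^ (2 * d) := by positivity
        nlinarith [sq_nonneg ρ]
      _ = _ := by ring
  have htail : ∀ v, ‖r (K + 1) v‖ ≤ G * Real.sqrt M * ρ ^ K := by
    intro v
    refine hnorm_le ((hrtail v).trans ?_)
    rw [hG2]
    calc ((d : ℝ) * (K + 1) + 1) ^ (d - 1) * (C ^ (2 * d) * ((ρ ^ 2) ^ K / (1 - ρ ^ 2)))
        ≤ P * M * (C ^ (2 * d) * ((ρ ^ 2) ^ K / (1 - ρ ^ 2))) := by
          rw [hPM]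
          gcongr
          nlinarith
      _ = _ := by ring
  have hrank : ∀ j ≤ K, (Module.finrank ℝ (U j) : ℝ) ≤ P * M * (q ^ d * 2 ^ j) := by
    intro j hj
    calc (Module.finrank ℝ (U j) : ℝ) ≤ ((j : ℝ) + 1) ^ (d - 1) * (q ^ d * 2 ^ j) := by
          exact_mod_cast hUrank j
      _ ≤ _ := by gcongr; exact hjK j hj
  have hcov : ∀ j < K + 1, HasCover (absHull fun s : Fin d → S => r j fun i => s i)
      (G * Real.sqrt K * τ ^ K * (1 / 2) ^ (K - j))
      (c * (2 ^ j * M + K) + P * M * (q ^ d * 2 ^ j) * (A * (K - j : ℕ)) * Real.log 5) := by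
    intro j hj
    have hj' : j ≤ K := by omega
    have := hUfin j
    refine (hasCover_absHull_of_mem (U j) (fun s => hUmem j hj' _) (fun s => hlev j hj' _)
      (by positivity) hN1 hcard (hm j).1 (A * (K - j)) (hrank j hj')).mono subset_rfl ?_ ?_
    · have h1 : (1 : ℝ) / 2 ^ (A * (K - j)) ≤ τ ^ (K - j) * (1 / 2) ^ (K - j) := by
        rw [pow_mul, ← one_div_pow, ← mul_pow]
        refine pow_le_pow_left₀ (by positivity) ?_ _
        rw [div_le_iff₀ (by positivity)]
        rw [div_le_iff₀ hτ0] at hA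
        linarith
      calc _ ≤ G * Real.sqrt K * τ ^ j * (1 / 2 ^ (A * (K - j))) := by
            rw [div_eq_mul_one_div _ ((2 : ℝ) ^ _)]
            gcongr
            exact (hm j).2.2
        _ ≤ G * Real.sqrt K * τ ^ j * (τ ^ (K - j) * (1 / 2) ^ (K - j)) := by gcongr
        _ = G * Real.sqrt K * (τ ^ j * τ ^ (K - j)) * (1 / 2) ^ (K - j) := by ring
        _ = _ := by rw [← pow_add, Nat.add_sub_cancel' hj']
    · have h1 : (⌈2 ^ j * M / K⌉₊ : ℝ) * Real.log (4 * N) ≤ c * (2 ^ j * M + K) := by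
        calc _ ≤ (⌈2 ^ j * M / K⌉₊ : ℝ) * (c * K) := by gcongr
          _ = c * ((⌈2 ^ j * M / K⌉₊ : ℝ) * K) := by ring
          _ ≤ _ := by gcongr; exact (hm j).2.1
      push_cast
      linarith
  -- The tail already has norm of order `√M ρ ^ K`, so Maurey's method alone reaches the target
  -- radius and no subspace is needed.
  have hcovtail : HasCover (absHull fun s : Fin d → S => r (K + 1) fun i => s i)
      (G * Real.sqrt K * τ ^ K) (c * (2 ^ K * M + K)) := by
    refine (hasCover_absHull (fun s => htail _) (by positivity) hN1 hcard (hm K).1).mono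
      subset_rfl (hm K).2.2 ?_
    calc _ ≤ (⌈2 ^ K * M / K⌉₊ : ℝ) * (c * K) := by gcongr
      _ = c * ((⌈2 ^ K * M / K⌉₊ : ℝ) * K) := by ring
      _ ≤ _ := by gcongr; exact (hm K).2.1
  have htot := (HasCover.sum hcov).add hcovtail
    (U := absHull fun s : Fin d → S => T fun i => ψ (s i)) fun u hu =>
      absHull_subset_sum (r := fun j (s : Fin d → S) => r j fun i => s i) (fun s => hsum _) hu
  have h2K : (K : ℝ) ≤ 2 ^ K := by exact_mod_cast Nat.lt_two_pow_self.le
  refine htot.mono subset_rfl ?_ ?_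
  · rw [← Finset.mul_sum]
    have h0 : 0 ≤ G * Real.sqrt K * τ ^ K := by positivity
    have := mul_le_mul_of_nonneg_left (sum_half_pow_le K) h0
    linarith
  · have h1 : ∑ j ∈ Finset.range (K + 1), (c * (2 ^ j * M + K)
        + P * M * (q ^ d * 2 ^ j) * (A * (K - j : ℕ)) * Real.log 5)
        = c * (M * ∑ j ∈ Finset.range (K + 1), (2 : ℝ) ^ j + K * (K + 1))
          + P * M * q ^ d * A * Real.log 5
            * ∑ j ∈ Finset.range (K + 1), (2 : ℝ) ^ j * ((K - j : ℕ) : ℝ) := by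
      rw [Finset.sum_add_distrib, ← Finset.mul_sum, Finset.sum_add_distrib, ← Finset.sum_mul,
        Finset.mul_sum (a := P * M * q ^ d * A * Real.log 5)]
      simp only [Finset.sum_const, Finset.card_range, nsmul_eq_mul]
      push_cast
      congr 1
      · ring
      · exact Finset.sum_congr rfl fun j _ => by ring
    rw [h1]
    have e1 := mul_le_mul_of_nonneg_left (sum_two_pow_mul_sub_le K)
      (show 0 ≤ P * M * q ^ d * A * Real.log 5 by positivity)
    have e2 : M * ∑ j ∈ Finset.range (K + 1), (2 : ℝ) ^ j + K * (K + 1) + (2 ^ K * M + K)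
        ≤ 8 * (2 ^ K * M) := by
      have a1 := mul_le_mul_of_nonneg_left (sum_two_pow_le K) (by linarith : 0 ≤ M)
      have a2 := mul_succ_le_two_pow K
      have a3 : (2 : ℝ) ^ K ≤ 2 ^ K * M := le_mul_of_one_le_right (by positivity) hM1
      linarith
    have e3 := mul_le_mul_of_nonneg_left e2 hc
    calc _ ≤ _ := add_le_add_left (add_le_add_right e1 _) _
      _ ≤ c * (8 * (2 ^ K * M)) + P * M * q ^ d * A * Real.log 5 * (2 * 2 ^ K) := by linarith
      _ = _ := by ring

end FixedLevel

/-! ### From scales indexed by `K` to all small radii -/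

section Asymptotics

theorem LesssimZero.exists_eventually_le {h : ℝ → EReal} {g : ℝ → ℝ} (hhg : LesssimZero h g)
    (hg : ∀ᶠ ε in 𝓝[>] (0 : ℝ), 0 < g ε) :
    ∃ C : ℝ, ∀ᶠ ε in 𝓝[>] (0 : ℝ), h ε ≤ ((g ε * C : ℝ) : EReal) := by
  obtain ⟨C, hC, -⟩ := EReal.lt_iff_exists_real_btwn.1 hhg
  refine ⟨C, ?_⟩
  filter_upwards [hg, eventually_lt_of_limsup_lt hC] with ε h1 h2
  rw [EReal.coe_mul]
  exact (EReal.div_le_iff_le_mul (by exact_mod_cast h1) (EReal.coe_ne_top _)).1 h2.le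

theorem lesssimZero_of_eventually_le {h : ℝ → EReal} {g : ℝ → ℝ} {C : ℝ}
    (hg : ∀ᶠ ε in 𝓝[>] (0 : ℝ), 0 < g ε ∧ h ε ≤ ((g ε * C : ℝ) : EReal)) : LesssimZero h g := by
  refine lt_of_le_of_lt (limsup_le_of_le (a := (C : EReal)) ?_ ?_) (EReal.coe_lt_top C)
  · exact isCobounded_le_of_bot
  · filter_upwards [hg] with ε hε
    rw [EReal.div_le_iff_le_mul (by exact_mod_cast hε.1) (EReal.coe_ne_top _), ← EReal.coe_mul]
    exact hε.2

/-- Passing from a geometric sequence of scales to all small radii. -/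
theorem lesssimZero_entropy_of_hasCover {E : Type*} [SeminormedAddCommGroup E] {F : Set E}
    {a p G B : ℝ} (ha : 0 < a) (hpa : p * a = 1) (hG : 0 < G) (hB : 0 ≤ B) (n K₀ : ℕ)
    (hF : ∀ K : ℕ, K₀ ≤ K → HasCover F (G * Real.sqrt K * ((2 : ℝ) ^ (-a)) ^ K)
      (B * 2 ^ K * (K : ℝ) ^ n)) :
    LesssimZero (entropy F)
      (fun ε => ε ^ (-p) * Real.log (1 / ε) ^ n * Real.log (1 / ε) ^ (p / 2)) := by
  have hp : 0 < p := by
    by_contra! h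
    nlinarith
  have hl2 : 0 < Real.log 2 := Real.log_pos (by norm_num)
  -- Chosen so that `K ≤ c * L`: for large `L` the three terms of `l` are at most `L`, `p * L` and
  -- `p / 2 * L`; the `+ 1` pays for rounding up.
  set c := (1 + 3 / 2 * p) / Real.log 2 + 1 with hc
  have hc0 : 0 < c := by positivity
  set b := p * |Real.log G + 1 / 2 * Real.log c| with hb
  have hb0 : 0 ≤ b := by positivity
  have hL : Tendsto (fun ε : ℝ => Real.log (1 / ε)) (𝓝[>] 0) atTop := by
    simp only [one_div, Real.log_inv]
    exact tendsto_neg_atBot_atTop.comp Real.tendsto_log_nhdsGT_zero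
  refine lesssimZero_of_eventually_le (C := B * (2 * Real.exp b) * c ^ n) ?_
  filter_upwards [self_mem_nhdsWithin, hL.eventually_ge_atTop (1 : ℝ),
    hL.eventually_ge_atTop b, hL.eventually_ge_atTop (K₀ * Real.log 2 / p)] with ε hε h1 hLb hLK
  have hε0 : 0 < ε := hε
  set L := Real.log (1 / ε) with hLdef
  have hL0 : 0 < L := by linarith
  have hlogε : Real.log ε = -L := by rw [hLdef, one_div, Real.log_inv, neg_neg]
  have hlogL0 : 0 ≤ Real.log L := Real.log_nonneg h1
  have hlogL : Real.log L ≤ L := by linarith [Real.log_le_sub_one_of_pos hL0]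
  have hY : ε ^ (-p) * L ^ n * L ^ (p / 2)
      = Real.exp (p * L + p / 2 * Real.log L) * L ^ n := by
    rw [Real.rpow_def_of_pos hε0, Real.rpow_def_of_pos hL0, hlogε, mul_right_comm,
      ← Real.exp_add]
    ring_nf
  refine ⟨by positivity, ?_⟩
  -- This solves `G √K 2^(-a K) ≤ ε` for `K log 2`, using `√K ≤ √(c L)` and `p = 1 / a`; `b` absorbs
  -- `G` and `√c`. Rounding `K` up costs the factor 2 in the final constant.
  set l := b + p * L + p / 2 * Real.log L with hl
  have hl0 : 0 < l := by positivity
  set K := ⌈l / Real.log 2⌉₊ with hK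
  have hK1 : l ≤ K * Real.log 2 := by
    rw [← div_le_iff₀ hl2]; exact Nat.le_ceil _
  have hK2 : K * Real.log 2 ≤ l + Real.log 2 := by
    have := (Nat.ceil_lt_add_one (by positivity : 0 ≤ l / Real.log 2)).le
    calc K * Real.log 2 ≤ (l / Real.log 2 + 1) * Real.log 2 := by gcongr
      _ = _ := by field_simp
  have hKc : (K : ℝ) ≤ c * L := by
    have h2 : l ≤ (1 + 3 / 2 * p) * L := by
      have : p / 2 * Real.log L ≤ p / 2 * L := by gcongr
      rw [hl]; linarith
    have := (Nat.ceil_lt_add_one (by positivity : 0 ≤ l / Real.log 2)).le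
    calc (K : ℝ) ≤ l / Real.log 2 + 1 := this
      _ ≤ (1 + 3 / 2 * p) * L / Real.log 2 + L := by gcongr
      _ = c * L := by rw [hc]; ring
  have hKK₀ : K₀ ≤ K := by
    have h2 : (K₀ : ℝ) * Real.log 2 ≤ K * Real.log 2 := by
      refine le_trans ?_ hK1
      rw [div_le_iff₀ hp] at hLK
      have : 0 ≤ p / 2 * Real.log L := by positivity
      rw [hl]; linarith
    exact_mod_cast le_of_mul_le_mul_right h2 hl2
  have h2K : (2 : ℝ) ^ K = Real.exp (K * Real.log 2) := by
    rw [← Real.rpow_natCast, Real.rpow_def_of_pos two_pos, mul_comm]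
  have hcov := (hF K hKK₀).mono (ε' := ε)
    (B' := ε ^ (-p) * L ^ n * L ^ (p / 2) * (B * (2 * Real.exp b) * c ^ n)) subset_rfl ?_ ?_
  · exact hcov.entropy_le
  · have e1 : ((2 : ℝ) ^ (-a)) ^ K = Real.exp (-(a * (K * Real.log 2))) := by
      rw [← Real.rpow_natCast, ← Real.rpow_mul two_pos.le, Real.rpow_def_of_pos two_pos]
      ring_nf
    have e2 : Real.sqrt K ≤ Real.exp (1 / 2 * (Real.log c + Real.log L)) := by
      rw [← Real.log_mul hc0.ne' hL0.ne', mul_comm, ← Real.rpow_def_of_pos (by positivity),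
        ← Real.sqrt_eq_rpow]
      exact Real.sqrt_le_sqrt hKc
    have e3 : ((2 : ℝ) ^ (-a)) ^ K ≤ Real.exp (-(a * l)) := by
      rw [e1]; gcongr
    have e4 : a * l = |Real.log G + 1 / 2 * Real.log c| + L + 1 / 2 * Real.log L := by
      have : a * l = (p * a) * (|Real.log G + 1 / 2 * Real.log c| + L + 1 / 2 * Real.log L) := by
        rw [hl, hb]; ring
      rw [this, hpa, one_mul]
    calc G * Real.sqrt K * ((2 : ℝ) ^ (-a)) ^ K
        ≤ Real.exp (Real.log G) * Real.exp (1 / 2 * (Real.log c + Real.log L))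
          * Real.exp (-(a * l)) := by rw [Real.exp_log hG]; gcongr
      _ = Real.exp (Real.log G + 1 / 2 * (Real.log c + Real.log L) + -(a * l)) := by
          rw [← Real.exp_add, ← Real.exp_add]
      _ ≤ Real.exp (Real.log ε) := by
          rw [hlogε, e4]
          refine Real.exp_le_exp.2 ?_
          have := le_abs_self (Real.log G + 1 / 2 * Real.log c)
          linarith
      _ = ε := Real.exp_log hε0
  · rw [hY]
    calc B * 2 ^ K * (K : ℝ) ^ n
        ≤ B * (Real.exp (l + Real.log 2)) * (c * L) ^ n := by rw [h2K]; gcongr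
      _ = _ := by
          rw [Real.exp_add, Real.exp_log two_pos, hl, add_assoc, Real.exp_add, mul_pow]
          ring

end Asymptotics

/-! ### The net in `Ψ` and the conclusion -/

section Main

/-- Covering balls may be centred outside the family; doubling the radius allows centres of the form
`ψ s`. -/
theorem exists_finset_net_of_coveringNum_le {E Θ : Type*} [SeminormedAddCommGroup E] [Nonempty Θ]
    {ψ : Θ → E} {η X : ℝ} (hη : 0 ≤ η) (h : (coveringNum (Set.range ψ) η : EReal) ≤ (X : EReal)) :
    ∃ S : Finset Θ, S.Nonempty ∧ (S.card : ℝ) ≤ X ∧ ∀ v, ∃ s ∈ S, ‖ψ v - ψ s‖ ≤ 2 * η := by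
  classical
  have h1 := Metric.coveringNumber_two_mul_le_externalCoveringNumber η.toNNReal (Set.range ψ)
  have hfin : Metric.externalCoveringNumber η.toNNReal (Set.range ψ) ≠ ⊤ := by
    intro htop
    rw [coveringNum, htop] at h
    simp at h
  obtain ⟨C, hCsub, hCfin, hCcov, hCcard⟩ :=
    Metric.exists_set_encard_eq_coveringNumber (ne_top_of_le_ne_top hfin h1)
  choose π hπ using fun c : C => hCsub c.2
  have := hCfin.fintype
  have hcov : ∀ v, ∃ s ∈ Finset.univ.image π, ‖ψ v - ψ s‖ ≤ 2 * η := by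
    intro v
    obtain ⟨c, hc, hvc⟩ := hCcov ⟨v, rfl⟩
    refine ⟨π ⟨c, hc⟩, Finset.mem_image_of_mem _ (Finset.mem_univ _), ?_⟩
    rw [hπ]
    simp only [Set.mem_ofPred_eq, edist_dist, dist_eq_norm] at hvc
    have h2 : ((2 * η.toNNReal : ℝ≥0) : ℝ≥0∞) = ENNReal.ofReal (2 * η) := by
      rw [ENNReal.ofReal, Real.toNNReal_mul (by norm_num)]
      simp
    rw [h2] at hvc
    exact (ENNReal.ofReal_le_ofReal_iff (by positivity)).1 hvc
  refine ⟨Finset.univ.image π, ?_, ?_, hcov⟩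
  · obtain ⟨s, hs, -⟩ := hcov (Classical.arbitrary Θ)
    exact ⟨s, hs⟩
  · have h3 : ((Finset.univ.image π).card : ℕ∞)
        ≤ Metric.externalCoveringNumber η.toNNReal (Set.range ψ) := by
      refine le_trans ?_ (hCcard.le.trans h1)
      rw [Set.encard_eq_coe_toFinset_card, Set.toFinset_card]
      exact_mod_cast Finset.card_image_le
    have h4 : (((Finset.univ.image π).card : ℕ) : ℝ≥0∞) ≤ coveringNum (Set.range ψ) η := by
      unfold coveringNum; exact_mod_cast h3
    have h5 : ((((Finset.univ.image π).card : ℕ) : ℝ≥0∞) : EReal) ≤ (X : EReal) :=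
      (EReal.coe_ennreal_le_coe_ennreal_iff.2 h4).trans h
    rw [← ENNReal.ofReal_natCast, EReal.coe_ennreal_ofReal, max_eq_left (by positivity)] at h5
    exact_mod_cast h5

end Main

end TensorEntropy

open TensorEntropy in
theorem mainTheorem4 (μ : MeasureTheory.Measure ℝ) [MeasureTheory.SigmaFinite μ]
    (d : ℕ) (hd : 1 ≤ d)
    (ψ : Set.Icc (0 : ℝ) 1 → MeasureTheory.Lp ℝ 2 μ) (hψ : ∀ v, ‖ψ v‖ ≤ 1)
    (V : ℝ) (hV : 0 < V)
    (hcov : TensorEntropy.LesssimZero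
      (fun ε => (TensorEntropy.coveringNum (Set.range ψ) ε : EReal)) (fun ε => ε ^ (-V)))
    (q : ℕ) (γ W : ℝ) (𝒱 : ℕ → Submodule ℝ (MeasureTheory.Lp ℝ 2 μ))
    (h𝒱 : TensorEntropy.IsNestedApprox ψ q γ W 𝒱) :
    TensorEntropy.LesssimZero
      (TensorEntropy.entropy (TensorEntropy.absconvTensor μ d ψ))
      (fun ε => ε ^ (-(2 * W / (2 + W))) * Real.log (1 / ε) ^ (d - 1)
        * Real.log (1 / ε) ^ (W / (2 + W))) := by
  have hW := h𝒱.W_pos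
  have hγ := h𝒱.γ_pos
  -- `finrank` is 0 in infinite dimension, so its positivity forces finite dimension.
  have hfin : ∀ k, FiniteDimensional ℝ (𝒱 k) := fun k =>
    Module.finite_of_finrank_pos (by
      rw [h𝒱.finrank_eq]; exact Nat.mul_pos h𝒱.q_pos (by positivity))
  set ρ : ℝ := (2 : ℝ) ^ (-(1 / W)) with hρ
  have hρ0 : 0 < ρ := by positivity
  have hρ1 : ρ < 1 := Real.rpow_lt_one_of_one_lt_of_neg one_lt_two (by
    rw [neg_lt_zero]; positivity)
  have happ : ∀ k, 1 ≤ k → ∀ v, ∃ f ∈ 𝒱 k, ‖ψ v - f‖ ≤ γ * ρ ^ k := by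
    intro k hk v
    obtain ⟨f, hf, hvf⟩ := h𝒱.approx k hk v
    refine ⟨f, hf, abs_le_of_sq_le_sq' ?_ (by positivity) |>.2⟩
    rw [norm_sub_sq_Lp_two, mul_pow]
    refine hvf.trans (le_of_eq ?_)
    rw [hρ, ← pow_mul, ← Real.rpow_natCast (_ ^ _ : ℝ) (k * 2), ← Real.rpow_mul two_pos.le]
    push_cast
    ring_nf
  set a : ℝ := 1 / W + 1 / 2 with ha
  have ha0 : 0 < a := by positivity
  have hτ : ρ / Real.sqrt 2 = (2 : ℝ) ^ (-a) := by
    rw [Real.sqrt_eq_rpow, hρ, ← Real.rpow_sub two_pos]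
    congr 1
    rw [ha]; ring
  set τ : ℝ := (2 : ℝ) ^ (-a) with hτdef
  have hτ0 : 0 < τ := by positivity
  have hτ1 : τ < 1 := Real.rpow_lt_one_of_one_lt_of_neg one_lt_two (by linarith)
  obtain ⟨C₁, hC₁⟩ := hcov.exists_eventually_le
    (by filter_upwards [self_mem_nhdsWithin] with ε hε using Real.rpow_pos_of_pos hε _)
  set C₀ := max 1 C₁ with hC₀
  have hC₀1 : 1 ≤ C₀ := le_max_left _ _
  have hlog4 : 0 ≤ Real.log 4 := Real.log_nonneg (by norm_num)
  have hlogC : 0 ≤ Real.log C₀ := Real.log_nonneg hC₀1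
  have hlogτ : 0 ≤ -Real.log τ := by linarith [Real.log_neg hτ0 hτ1]
  -- With `N ≤ C₀ τ^(-K V)` net points, `log (4 * N ^ d)` is at most `c * K` for `K ≥ 1`.
  set c := Real.log 4 + d * (Real.log C₀ + V * (-Real.log τ)) with hc
  obtain ⟨G, B, hG, hB, hGB⟩ := exists_hasCover_absHull_tensor (tensorMap μ d) (inner_tensor μ) hd
    h𝒱.nested h𝒱.finrank_eq hγ hρ0 hρ1 hψ happ (c := c) (by positivity)
  rw [hτ] at hGB
  have htend : Tendsto (fun K : ℕ => τ ^ K) atTop (𝓝[>] 0) :=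
    tendsto_nhdsWithin_iff.2 ⟨tendsto_pow_atTop_nhds_zero_of_lt_one hτ0.le hτ1,
      Eventually.of_forall fun K => pow_pos hτ0 K⟩
  obtain ⟨K₀, hK₀⟩ := eventually_atTop.1 (htend.eventually hC₁)
  -- The `2 * d` accounts for moving each of the `d` factors by at most `2 * τ ^ K`, which is no
  -- more than `2 * √K * τ ^ K`.
  have hmain : ∀ K : ℕ, max K₀ 1 ≤ K → HasCover (absconvTensor μ d ψ)
      ((G + 2 * d) * Real.sqrt K * τ ^ K) (B * 2 ^ K * (K : ℝ) ^ (d - 1)) := by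
    intro K hK
    have hK1 : 1 ≤ K := (le_max_right _ _).trans hK
    have hK1' : (1 : ℝ) ≤ K := by exact_mod_cast hK1
    have hτK : 0 < τ ^ K := by positivity
    obtain ⟨S, hSne, hScard, hS⟩ :=
      exists_finset_net_of_coveringNum_le hτK.le (hK₀ K ((le_max_left _ _).trans hK))
    have hS0 : (0 : ℝ) < S.card := by exact_mod_cast hSne.card_pos
    have hlog : Real.log (4 * (S.card : ℝ) ^ d) ≤ c * K := by
      have h1 : Real.log S.card ≤ Real.log C₀ + V * (-Real.log τ) * K := by
        calc Real.log S.card ≤ Real.log ((τ ^ K) ^ (-V) * C₀) := by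
              refine Real.log_le_log hS0 (hScard.trans ?_)
              gcongr
              exact le_max_right _ _
          _ = _ := by
              rw [Real.log_mul (by positivity) (by positivity), Real.log_rpow hτK, Real.log_pow]
              ring
      rw [Real.log_mul (by norm_num) (by positivity), Real.log_pow]
      have h2 : (d : ℝ) * Real.log S.card ≤ d * (Real.log C₀ + V * (-Real.log τ) * K) := by gcongr
      have h3 : Real.log 4 ≤ Real.log 4 * K := le_mul_of_one_le_right hlog4 hK1'
      have h4 : (d : ℝ) * Real.log C₀ ≤ d * Real.log C₀ * K :=
        le_mul_of_one_le_right (by positivity) hK1'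
      rw [hc]
      linarith
    have hhull := hGB K hK1 S hSne hlog
    refine ((hhull.thicken (ε' := d * (2 * τ ^ K)) ?_).closure).mono subset_rfl ?_ le_rfl
    · rintro _ ⟨A, β, hβ, rfl⟩
      exact exists_absHull_tensor_near (tensorMap μ d) (inner_tensor μ) hψ (by positivity) hS
        _ β hβ
    · have h1 : 1 ≤ Real.sqrt K := Real.one_le_sqrt.2 hK1'
      have h2 : (d : ℝ) * (2 * τ ^ K) ≤ d * (2 * τ ^ K) * Real.sqrt K :=
        le_mul_of_one_le_right (by positivity) h1
      linarith
  have hp : 2 * W / (2 + W) * a = 1 := by rw [ha]; field_simp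
  have := lesssimZero_entropy_of_hasCover ha0 hp (by positivity) hB (d - 1) _ hmain
  rwa [show 2 * W / (2 + W) / 2 = W / (2 + W) by ring] at this
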